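/- **Setting.** Let all resistances $R_1,R_2,R_4,R_5,R_7,R_{01},R_{02},R_{04},R_{08}$, capacitances $C_1,C_2,C_4,C_5,C_7,C_9$, inductances $L_3,L_6,L_8$ and the constant source voltages $V_{PV},V_B,V_S$ be positive, and let $R_L>0$. Consider the DC microgrid $$\begin{aligned} \dot x_1&=-\tfrac{x_1}{R_1C_1}-\tfrac{x_3}{C_1}+\tfrac{V_{PV}}{R_1C_1},\qquad \dot x_2=-\tfrac{x_2}{R_2C_2}+\tfrac{x_3}{C_2}-\tfrac{u_1x_3}{C_2}+\tfrac{x_9}{R_2C_2},\\ \dot x_3&=\tfrac1{L_3}(x_1-x_2-R_{01}x_3)+\tfrac1{L_3}\bigl(x_2+(R_{01}-R_{02})x_3\bigr)u_1,\\ \dot x_4&=-\tfrac{x_4}{R_4C_4}-\tfrac{x_6}{C_4}+\tfrac{V_B}{R_4C_4},\qquad \dot x_5=-\tfrac{x_5}{R_5C_5}+\tfrac{x_6}{C_5}-\tfrac{u_2x_6}{C_5}+\tfrac{x_9}{R_5C_5},\\ \dot x_6&=\tfrac1{L_6}\bigl(x_4-x_5-R_{04}x_6+x_5u_2\bigr),\qquad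 \dot x_7=-\tfrac{x_7}{R_7C_7}-\tfrac{x_8}{C_7}+\tfrac{x_9}{R_7C_7},\\ \dot x_8&=\tfrac1{L_8}\bigl(V_Su_3-R_{08}x_8-x_7\bigr),\qquad \dot x_9=\tfrac1{C_9}\Bigl[\tfrac{x_2-x_9}{R_2}+\tfrac{x_5-x_9}{R_5}+\tfrac{x_7-x_9}{R_7}-\tfrac{x_9}{R_L}\Bigr]. \end{aligned}$$ **References.** For constants $x_1^*,x_4^*,x_9^*$ put $a_2=\frac{R_{01}-R_{02}}{R_1}(V_{PV}-x_1^*)$, $\Delta_2=\frac{1}{R_1C_2}(V_{PV}-x_1^*)\bigl[x_1^*-\frac{R_{02}}{R_1}(V_{PV}-x_1^*)\bigr]$, $\Delta_5=\frac1{R_4C_5}(V_B-x_4^*)\bigl[x_4^*-\frac{R_{04}}{R_4}(V_B-x_4^*)\bigr]$, $$x_2^*=\tfrac{x_9^*-a_2}{2}+\tfrac12\sqrt{(x_9^*-a_2)^2+4(R_2C_2\Delta_2+a_2x_9^*)},\qquad x_5^*=\tfrac{x_9^*}{2}+\tfrac12\sqrt{{x_9^*}^2+4R_5C_5\Delta_5},$$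 $$x^e=\bigl(x_1^*,\,x_2^*,\,\tfrac{V_{PV}-x_1^*}{R_1},\,x_4^*,\,x_5^*,\,\tfrac{V_B-x_4^*}{R_4},\,x_9^*,\,0,\,x_9^*\bigr).$$ The *current balance* for $(R_L,x_1^*,x_4^*,x_9^*)$ says that both square roots are real and $\frac{x_9^*}{R_L}=\frac{x_2^*-x_9^*}{R_2}+\frac{x_5^*-x_9^*}{R_5}$. Let $\gamma_1=\frac{R_{01}/R_1}{1+R_{01}/R_1}$, $\gamma_2=\frac{R_{04}/R_4}{1+R_{04}/R_4}$, $\beta=\frac{x_9^*+(R_5/R_4-R_{04}/R_4)V_B}{1+R_5/R_4-R_{04}/R_4}$, where the denominator of $\beta$ is nonzero, and let $\Omega_{R_L}$ be the set of all $R_L>0$ for which the current balance holds for some $x_1^*\in[\gamma_1V_{PV},V_{PV}]$ and some $x_4^*\in[\gamma_2V_B,\beta]$. **Control laws.** With integrator states given by $\dot\alpha_1=K_1^\alpha(x_1-x_1^*)$, $\dot\alpha_3=K_3^\alpha(x_3-z_3)$, $\dot\alpha_4=K_4^\alpha(x_4-x_4^*)$, $\dot\alpha_6=K_6^\alpha(x_6-z_6)$,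 let $$\begin{aligned} z_3&=\tfrac{V_{PV}-x_1}{R_1}+C_1K_1(x_1-x_1^*)+C_1\overline K_1\alpha_1,\qquad z_6=\tfrac{V_{B}-x_4}{R_4}+C_4K_4(x_4-x_4^*)+C_4\overline K_4\alpha_4,\\ v_1&=K_3(x_3-z_3)+\overline K_3\alpha_3-C_1\overline K_1K_1^\alpha(x_1-x_1^*)+\bigl(C_1K_1-\tfrac1{R_1}\bigr)\bigl(K_1(x_1-x_1^*)+\overline K_1\alpha_1\bigr),\\ v_2&=-K_6(x_6-z_6)-\overline K_6\alpha_6+C_4\overline K_4K_4^\alpha(x_4-x_4^*)-\bigl(C_4K_4-\tfrac1{R_4}\bigr)\bigl(K_4(x_4-x_4^*)+\overline K_4\alpha_4\bigr),\\ u_1&=\frac{-x_1+x_2+R_{01}x_3-L_3v_1}{x_2+(R_{01}-R_{02})x_3},\qquad u_2=\frac{-x_4+x_5+R_{04}x_6+L_6v_2}{x_5},\\ z_7&=-\tfrac{R_7}{x_9}(x_2-x_2^*)\Bigl(\tfrac{x_9-x_2^*}{R_2}+x_3(1-u_1)\Bigr)-\tfrac{R_7}{x_9}(x_5-x_5^*)\Bigl(\tfrac{x_9-x_5^*}{R_5}+x_6(1-u_2)\Bigr)\\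 &\qquad+R_7\Bigl[\tfrac{x_9}{R_L}-\tfrac{x_2-x_9}{R_2}-\tfrac{x_5-x_9}{R_5}\Bigr]+\tfrac1{x_9}\bigl(-{x_9^*}^2+2x_9x_9^*\bigr),\\ z_8&=C_7K_7(x_7-z_7)-\tfrac1{R_7}(x_7-x_9)-C_7\dot z_7,\qquad u_3=\tfrac1{V_S}\bigl[x_7+R_{08}x_8+L_8\dot z_8-L_8K_8(x_8-z_8)\bigr], \end{aligned}$$ where dots denote time derivatives along the closed loop; $\dot z_7$, $\ddot z_7$ and $\dot z_8$ do not involve $u_3$, so the $u_i$ are functions of the state $(x,\alpha)\in\mathbb R^9\times\mathbb R^4$. They are defined where $x_2+(R_{01}-R_{02})x_3\ne0$, $x_5\neq0$, $x_9\ne0$. The gains are *proper* if $K_1,K_3,K_4,K_6,K_7,K_8>0$ and each of the two linear loops is asymptotically stable in the following sense. In the PV loop, either $\overline K_1,K_1^\alpha,\overline K_3,K_3^\alpha>0$ and the matrix $$\begin{pmatrix}-\frac1{R_1C_1}&0&-\frac1{C_1}&0\\K_1^\alpha&0&0&0\\(K_3-K_1)(C_1K_1-\frac1{R_1})+C_1\overline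 K_1K_1^\alpha&\overline K_1(K_3C_1-K_1C_1+\frac1{R_1})&-K_3&-\overline K_3\\K_3^\alpha(\frac1{R_1}-C_1K_1)&-K_3^\alpha C_1\overline K_1&K_3^\alpha&0\end{pmatrix}$$ of the equations of $(x_1,\alpha_1,x_3,\alpha_3)$ is Hurwitz (all complex eigenvalues have negative real part), or $\overline K_1=K_1^\alpha=\overline K_3=K_3^\alpha=0$ and its $2\times2$ submatrix belonging to $(x_1,x_3)$ is Hurwitz. In the battery loop, the same holds with the indices $1,3$ replaced by $4,6$. A closed-loop trajectory is a solution on $[0,\infty)$ of the system with these laws and integrators that stays where the laws are defined. A set of states is *invariant* if a closed-loop trajectory starts at each of its points and all closed-loop trajectories starting in the set remain in it. Let $\Omega_K$ be the largest invariant set on which $u_1,u_2,u_3\in[0,1]$ (the union of all such sets). **Statement.** Let $\max(V_{PV},V_B)<x_9^*<V_S$, $R_L\in\Omega_{R_L}$, $x_1^*\in[\gamma_1V_{PV},V_{PV}]$ and $x_4^*\in[\gamma_2V_B,\beta]$ be such that the current balance holds, and let the gains be proper. Then for every initial state in $\Omega_K$ a closed-loop trajectory exists, and along every closed-loop trajectory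 starting there $x(t)\to x^e$ as $t\to\infty$ and $u_1,u_2,u_3\in[0,1]$ for all $t\ge0$. -/

import Mathlib

open Set Filter Topology

noncomputable section

namespace DCGrid

/-- The circuit constants and the (constant) source voltages of the microgrid. The load resistance
is kept apart. -/
structure Params where
  (R1 R2 R4 R5 R7 R01 R02 R04 R08 : ℝ)
  (C1 C2 C4 C5 C7 C9 : ℝ)
  (L3 L6 L8 : ℝ)
  (VPV VB VS : ℝ)

/-- All circuit constants and source voltages are positive. -/
structure Params.Positive (m : Params) : Prop where
  (R1 : 0 < m.R1) (R2 : 0 < m.R2) (R4 : 0 < m.R4) (R5 : 0 < m.R5) (R7 : 0 < m.R7)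
  (R01 : 0 < m.R01) (R02 : 0 < m.R02) (R04 : 0 < m.R04) (R08 : 0 < m.R08)
  (C1 : 0 < m.C1) (C2 : 0 < m.C2) (C4 : 0 < m.C4) (C5 : 0 < m.C5) (C7 : 0 < m.C7) (C9 : 0 < m.C9)
  (L3 : 0 < m.L3) (L6 : 0 < m.L6) (L8 : 0 < m.L8)
  (VPV : 0 < m.VPV) (VB : 0 < m.VB) (VS : 0 < m.VS)

/-- The constant references `x₁*`, `x₄*`, `x₉*`. -/
structure Refs where
  (x1 x4 x9 : ℝ)

/-- The gains of one of the two current loops. For the PV loop these are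
`K₁, K̄₁, K₁^α, K₃, K̄₃, K₃^α` in this order, for the battery loop
`K₄, K̄₄, K₄^α, K₆, K̄₆, K₆^α`. -/
structure LoopGains where
  (kv kvBar kvInt ki kiBar kiInt : ℝ)

/-- All the gains of the controller. -/
structure Gains where
  (pv bat : LoopGains)
  (K7 K8 : ℝ)

/-! ### State space

The state of the closed loop consists of the plant state `(x₁, …, x₉)` and of the states
`(α₁, α₃, α₄, α₆)` of the integrators inside the laws `u₁` and `u₂`. -/

abbrev State := (Fin 9 → ℝ) × (Fin 4 → ℝ)

namespace State

abbrev x1 (s : State) : ℝ := s.1 0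
abbrev x2 (s : State) : ℝ := s.1 1
abbrev x3 (s : State) : ℝ := s.1 2
abbrev x4 (s : State) : ℝ := s.1 3
abbrev x5 (s : State) : ℝ := s.1 4
abbrev x6 (s : State) : ℝ := s.1 5
abbrev x7 (s : State) : ℝ := s.1 6
abbrev x8 (s : State) : ℝ := s.1 7
abbrev x9 (s : State) : ℝ := s.1 8
abbrev al1 (s : State) : ℝ := s.2 0
abbrev al3 (s : State) : ℝ := s.2 1
abbrev al4 (s : State) : ℝ := s.2 2
abbrev al6 (s : State) : ℝ := s.2 3

end State

/-! ### The averaged model of the microgrid -/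

/-- The vector field of the nine-dimensional plant, for given values of the duty cycles. -/
def plant (m : Params) (RL : ℝ) (s : State) (u1 u2 u3 : ℝ) : Fin 9 → ℝ :=
  ![-(1 / (m.R1 * m.C1)) * s.x1 - 1 / m.C1 * s.x3 + 1 / (m.R1 * m.C1) * m.VPV,
    -(1 / (m.R2 * m.C2)) * s.x2 + 1 / m.C2 * s.x3 - 1 / m.C2 * u1 * s.x3
      + 1 / (m.R2 * m.C2) * s.x9,
    1 / m.L3 * (s.x1 - s.x2 - m.R01 * s.x3)
      + 1 / m.L3 * (s.x2 + (m.R01 - m.R02) * s.x3) * u1,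
    -(1 / (m.R4 * m.C4)) * s.x4 - 1 / m.C4 * s.x6 + 1 / (m.R4 * m.C4) * m.VB,
    -(1 / (m.R5 * m.C5)) * s.x5 + 1 / m.C5 * s.x6 - 1 / m.C5 * u2 * s.x6
      + 1 / (m.R5 * m.C5) * s.x9,
    1 / m.L6 * s.x4 - 1 / m.L6 * s.x5 - m.R04 / m.L6 * s.x6 + 1 / m.L6 * s.x5 * u2,
    -(1 / (m.R7 * m.C7)) * s.x7 - 1 / m.C7 * s.x8 + 1 / (m.R7 * m.C7) * s.x9,
    1 / m.L8 * m.VS * u3 - m.R08 / m.L8 * s.x8 - 1 / m.L8 * s.x7,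
    1 / m.C9 * ((s.x2 - s.x9) / m.R2 + (s.x5 - s.x9) / m.R5 + (s.x7 - s.x9) / m.R7
      - s.x9 * (1 / RL))]

/-! ### Equilibrium values -/

def gamma1 (m : Params) : ℝ := m.R01 / m.R1 * (1 / (1 + m.R01 / m.R1))

def gamma2 (m : Params) : ℝ := m.R04 / m.R4 * (1 / (1 + m.R04 / m.R4))

def beta (m : Params) (x9 : ℝ) : ℝ :=
  (x9 + (m.R5 / m.R4 - m.R04 / m.R4) * m.VB) / (1 + m.R5 / m.R4 - m.R04 / m.R4)

def a2 (m : Params) (r : Refs) : ℝ := (m.R01 - m.R02) / m.R1 * (m.VPV - r.x1)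

def delta2 (m : Params) (r : Refs) : ℝ :=
  1 / (m.R1 * m.C2) * (m.VPV - r.x1) * (r.x1 - m.R02 / m.R1 * (m.VPV - r.x1))

def radicand2 (m : Params) (r : Refs) : ℝ :=
  (r.x9 - a2 m r) ^ 2 + 4 * (m.R2 * m.C2 * delta2 m r + a2 m r * r.x9)

/-- The value `x₂*`, at which the second line of the model is in equilibrium. -/
def x2Star (m : Params) (r : Refs) : ℝ :=
  (r.x9 - a2 m r) / 2 + 1 / 2 * √(radicand2 m r)

def delta5 (m : Params) (r : Refs) : ℝ :=
  1 / (m.R4 * m.C5) * (m.VB - r.x4) * (r.x4 - m.R04 / m.R4 * (m.VB - r.x4))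

def radicand5 (m : Params) (r : Refs) : ℝ :=
  r.x9 ^ 2 + 4 * m.R5 * m.C5 * delta5 m r

/-- The value `x₅*`, at which the fifth line of the model is in equilibrium. -/
def x5Star (m : Params) (r : Refs) : ℝ :=
  r.x9 / 2 + 1 / 2 * √(radicand5 m r)

/-- The point `xᵉ`. -/
def xEq (m : Params) (r : Refs) : Fin 9 → ℝ :=
  ![r.x1, x2Star m r, 1 / m.R1 * (m.VPV - r.x1), r.x4, x5Star m r, 1 / m.R4 * (m.VB - r.x4),
    r.x9, 0, r.x9]

/-- The balance of the currents. It presupposes that the real square roots in `x₂*` and `x₅*`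
exist. -/
def CurrentBalance (m : Params) (RL : ℝ) (r : Refs) : Prop :=
  0 ≤ radicand2 m r ∧ 0 ≤ radicand5 m r ∧
    1 / RL * r.x9 = 1 / m.R2 * (x2Star m r - r.x9) + 1 / m.R5 * (x5Star m r - r.x9)

/-- The admissible load resistances `Ω_{R_L}` for a given `x₉*`. -/
def OmegaRL (m : Params) (x9 : ℝ) : Set ℝ :=
  {RL | 0 < RL ∧ ∃ x1 ∈ Icc (gamma1 m * m.VPV) m.VPV,
    ∃ x4 ∈ Icc (gamma2 m * m.VB) (beta m x9), CurrentBalance m RL ⟨x1, x4, x9⟩}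

/-! ### The laws `u₁` and `u₂` -/

def z3 (m : Params) (g : Gains) (r : Refs) (s : State) : ℝ :=
  1 / m.R1 * (m.VPV - s.x1) + m.C1 * g.pv.kv * (s.x1 - r.x1) + m.C1 * g.pv.kvBar * s.al1

def v1 (m : Params) (g : Gains) (r : Refs) (s : State) : ℝ :=
  g.pv.ki * (s.x3 - z3 m g r s) + g.pv.kiBar * s.al3
    - m.C1 * g.pv.kvBar * g.pv.kvInt * (s.x1 - r.x1)
    + (m.C1 * g.pv.kv - 1 / m.R1) * (g.pv.kv * (s.x1 - r.x1) + g.pv.kvBar * s.al1)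

def u1 (m : Params) (g : Gains) (r : Refs) (s : State) : ℝ :=
  1 / (s.x2 + (m.R01 - m.R02) * s.x3) *
    (-s.x1 + s.x2 + m.R01 * s.x3 - m.L3 * v1 m g r s)

def z6 (m : Params) (g : Gains) (r : Refs) (s : State) : ℝ :=
  1 / m.R4 * (m.VB - s.x4) + m.C4 * g.bat.kv * (s.x4 - r.x4) + m.C4 * g.bat.kvBar * s.al4

def v2 (m : Params) (g : Gains) (r : Refs) (s : State) : ℝ :=
  -g.bat.ki * (s.x6 - z6 m g r s) - g.bat.kiBar * s.al6
    + m.C4 * g.bat.kvBar * g.bat.kvInt * (s.x4 - r.x4)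
    - (m.C4 * g.bat.kv - 1 / m.R4) * (g.bat.kv * (s.x4 - r.x4) + g.bat.kvBar * s.al4)

def u2 (m : Params) (g : Gains) (r : Refs) (s : State) : ℝ :=
  1 / s.x5 * (-s.x4 + s.x5 + m.R04 * s.x6 + m.L6 * v2 m g r s)

/-- The set of states at which all the control laws are defined. -/
def domain (m : Params) : Set State :=
  {s | s.x2 + (m.R01 - m.R02) * s.x3 ≠ 0 ∧ s.x5 ≠ 0 ∧ s.x9 ≠ 0}

/-- The right-hand side for the full state, with `u₁`, `u₂` and the integrators in the loop and
with the value of `u₃` left free. -/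
def partialField (m : Params) (RL : ℝ) (g : Gains) (r : Refs) (s : State) (w : ℝ) : State :=
  (plant m RL s (u1 m g r s) (u2 m g r s) w,
    ![g.pv.kvInt * (s.x1 - r.x1), g.pv.kiInt * (s.x3 - z3 m g r s),
      g.bat.kvInt * (s.x4 - r.x4), g.bat.kiInt * (s.x6 - z6 m g r s)])

/-! ### The law `u₃` -/

/-- Time derivative along the closed loop of a function `φ` of the state. It is only applied to
functions `φ` that do not depend on `x₈`. As `u₃` enters the equation of `x₈` alone, the value
inserted for `u₃` (here `0`) is then immaterial. -/
def timeDeriv (m : Params) (RL : ℝ) (g : Gains) (r : Refs) (φ : State → ℝ) (s : State) : ℝ :=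
  fderiv ℝ φ s (partialField m RL g r s 0)

def z7 (m : Params) (RL : ℝ) (g : Gains) (r : Refs) (s : State) : ℝ :=
  -m.R7 * (1 / s.x9) * ((s.x2 - x2Star m r) *
      (1 / m.R2 * (s.x9 - x2Star m r) + s.x3 * (1 - u1 m g r s)))
    - m.R7 * (1 / s.x9) * ((s.x5 - x5Star m r) *
      (1 / m.R5 * (s.x9 - x5Star m r) + s.x6 * (1 - u2 m g r s)))
    + m.R7 * (s.x9 / RL - 1 / m.R2 * (s.x2 - s.x9) - 1 / m.R5 * (s.x5 - s.x9))
    + 1 / s.x9 * (-r.x9 ^ 2 + 2 * s.x9 * r.x9)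

/-- `ż₇`. -/
def z7Dot (m : Params) (RL : ℝ) (g : Gains) (r : Refs) : State → ℝ :=
  timeDeriv m RL g r (z7 m RL g r)

/-- `z̈₇`. -/
def z7DDot (m : Params) (RL : ℝ) (g : Gains) (r : Refs) : State → ℝ :=
  timeDeriv m RL g r (z7Dot m RL g r)

def z8 (m : Params) (RL : ℝ) (g : Gains) (r : Refs) (s : State) : ℝ :=
  m.C7 * g.K7 * (s.x7 - z7 m RL g r s) - 1 / m.R7 * (s.x7 - s.x9) - m.C7 * z7Dot m RL g r s

/-- `ż₈`; the equations of `x₇` and of `x₉`, which give `ẋ₇` and `ẋ₉`, do not involve `u₃`. -/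
def z8Dot (m : Params) (RL : ℝ) (g : Gains) (r : Refs) (s : State) : ℝ :=
  m.C7 * g.K7 * ((partialField m RL g r s 0).x7 - z7Dot m RL g r s)
    - 1 / m.R7 * ((partialField m RL g r s 0).x7 - (partialField m RL g r s 0).x9)
    - m.C7 * z7DDot m RL g r s

def u3 (m : Params) (RL : ℝ) (g : Gains) (r : Refs) (s : State) : ℝ :=
  1 / m.VS * (s.x7 + m.R08 * s.x8 + m.L8 * z8Dot m RL g r s
    - m.L8 * g.K8 * (s.x8 - z8 m RL g r s))

/-! ### Proper choice of the gains -/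

/-- A real matrix is Hurwitz if all its complex eigenvalues have negative real part. -/
def IsHurwitz {n : ℕ} (A : Matrix (Fin n) (Fin n) ℝ) : Prop :=
  ∀ μ ∈ spectrum ℂ (A.map (algebraMap ℝ ℂ)), μ.re < 0

/-- The matrix of the linear closed-loop equations of `(x₁, α₁, x₃, α₃)`, for `R = R₁` and
`C = C₁`, or of `(x₄, α₄, x₆, α₆)`, for `R = R₄` and `C = C₄`. -/
def loopMatrix (R C : ℝ) (k : LoopGains) : Matrix (Fin 4) (Fin 4) ℝ :=
  !![-(1 / (R * C)), 0, -(1 / C), 0;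
    k.kvInt, 0, 0, 0;
    (k.ki - k.kv) * (C * k.kv - 1 / R) + C * k.kvBar * k.kvInt,
      k.kvBar * (k.ki * C - k.kv * C + 1 / R), -k.ki, -k.kiBar;
    k.kiInt * (1 / R - C * k.kv), -k.kiInt * C * k.kvBar, k.kiInt, 0]

/-- The gains of a loop are properly chosen if the linear loop is asymptotically stable: either
all gains are positive and the matrix of the loop with its integrators is Hurwitz, or the
integral terms are switched off and the matrix of the loop without integrators
(the rows and columns of the two physical states) is Hurwitz. -/
def LoopGains.Proper (k : LoopGains) (R C : ℝ) : Prop :=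
  0 < k.kv ∧ 0 < k.ki ∧
    ((0 < k.kvBar ∧ 0 < k.kvInt ∧ 0 < k.kiBar ∧ 0 < k.kiInt ∧ IsHurwitz (loopMatrix R C k)) ∨
      (k.kvBar = 0 ∧ k.kvInt = 0 ∧ k.kiBar = 0 ∧ k.kiInt = 0 ∧
        IsHurwitz ((loopMatrix R C k).submatrix ![0, 2] ![0, 2])))

def Gains.Proper (g : Gains) (m : Params) : Prop :=
  g.pv.Proper m.R1 m.C1 ∧ g.bat.Proper m.R4 m.C4 ∧ 0 < g.K7 ∧ 0 < g.K8

/-! ### The closed loop and the set `Ω_K` -/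

/-- The closed-loop vector field. -/
def closedLoop (m : Params) (RL : ℝ) (g : Gains) (r : Refs) (s : State) : State :=
  partialField m RL g r s (u3 m RL g r s)

/-- A closed-loop trajectory on `[0, ∞)`, along which the control laws are defined. -/
def IsTrajectory (m : Params) (RL : ℝ) (g : Gains) (r : Refs) (z : ℝ → State) : Prop :=
  ∀ t : ℝ, 0 ≤ t → z t ∈ domain m ∧
    HasDerivWithinAt z (closedLoop m RL g r (z t)) (Ici 0) t

/-- A set is invariant if a closed-loop trajectory starts from each of its points, and all such
trajectories remain in the set. -/
def IsInvariantSet (m : Params) (RL : ℝ) (g : Gains) (r : Refs) (S : Set State) : Prop :=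
  ∀ z₀ ∈ S, (∃ z, IsTrajectory m RL g r z ∧ z 0 = z₀) ∧
    ∀ z, IsTrajectory m RL g r z → z 0 = z₀ → ∀ t : ℝ, 0 ≤ t → z t ∈ S

/-- All three duty cycles lie in `[0, 1]`. -/
def DutyBounded (m : Params) (RL : ℝ) (g : Gains) (r : Refs) (s : State) : Prop :=
  u1 m g r s ∈ Icc (0 : ℝ) 1 ∧ u2 m g r s ∈ Icc (0 : ℝ) 1 ∧ u3 m RL g r s ∈ Icc (0 : ℝ) 1

/-- The set `Ω_K`: the union of all invariant sets on which the duty cycles lie in `[0, 1]`. -/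
def OmegaK (m : Params) (RL : ℝ) (g : Gains) (r : Refs) : Set State :=
  ⋃₀ {S | IsInvariantSet m RL g r S ∧ ∀ s ∈ S, DutyBounded m RL g r s}

/-- `Ω_K` is indeed the largest of these sets. -/
theorem isGreatest_omegaK (m : Params) (RL : ℝ) (g : Gains) (r : Refs) :
    IsGreatest {S | IsInvariantSet m RL g r S ∧ ∀ s ∈ S, DutyBounded m RL g r s}
      (OmegaK m RL g r) := by
  refine ⟨⟨?_, ?_⟩, fun S hS => subset_sUnion_of_mem hS⟩
  · rintro z₀ ⟨S, hS, hz⟩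
    refine ⟨(hS.1 z₀ hz).1, fun z hz' h0 t ht => ⟨S, hS, (hS.1 z₀ hz).2 z hz' h0 t ht⟩⟩
  · rintro s ⟨S, hS, hs⟩
    exact hS.2 s hs

end DCGrid

end

open Set Filter Topology MeasureTheory

namespace DCGrid

/-! On `Ω_K` existence of trajectories and the duty bounds come from invariance, so only convergence
needs an argument. It rests on a cascade. The laws `u1` and `u2` cancel the nonlinearities of the
inductor currents, which leaves two autonomous linear loops with Hurwitz matrices: the errors of
`x₁, x₃` and `x₄, x₆` decay exponentially. The law `u3` is a two-step backstepping: `x₈ - z8` decays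
at rate `K8` and drives `x₇ - z7`, which therefore decays exponentially as well
(`IsTrajectory.expDecay_x7_sub_z7`).

For the remaining voltages, `z7` is designed so that the energy with weights `C₉, C₂, C₅` in `x₉`,
`x₂ - x₂*`, `x₅ - x₅*` loses a positive definite quadratic form in `x₂ - x₂*`, `x₅ - x₅*`, `x₉ -
x₉*`, up to the error `x₉ (x₇ - z7) / R₇` (`energy_balance`). Since that error is an exponentially
small multiple of the energy plus one, the energy stays bounded and converges, and the dissipation
is integrable (`tendsto_of_energy`). Barbalat's lemma gives `x₂` and `x₅`. It is not applied to
`x₉`, whose derivative contains `1 / x₉`; instead the limit of the energy gives a limit of `x₉²`,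
the sign of `x₉` cannot change, and integrability identifies the limit.

Finally the current balance gives `z7 → x₉*`, hence `x₇ → x₉*`. Then `ẋ₇ → 0`, because `ẍ₇` is
bounded, and the equation of `x₇` forces `x₈ → 0`. -/

/-! ### Exponential decay and Hurwitz systems. -/

/-- Exponential decay on the half-line `[0, ∞)`. -/
def ExpDecay {E : Type*} [Norm E] (f : ℝ → E) : Prop :=
  ∃ C c : ℝ, 0 ≤ C ∧ 0 < c ∧ ∀ t : ℝ, 0 ≤ t → ‖f t‖ ≤ C * Real.exp (-c * t)

theorem ExpDecay.of_norm_le {E F : Type*} [Norm E] [Norm F] {f : ℝ → E} {g : ℝ → F}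
    (hf : ExpDecay f) (K : ℝ) (hK : 0 ≤ K) (h : ∀ t, 0 ≤ t → ‖g t‖ ≤ K * ‖f t‖) :
    ExpDecay g := by
  obtain ⟨C, c, hC, hc, hb⟩ := hf
  refine ⟨K * C, c, mul_nonneg hK hC, hc, fun t ht => (h t ht).trans ?_⟩
  rw [mul_assoc]
  exact mul_le_mul_of_nonneg_left (hb t ht) hK

theorem tendsto_const_mul_exp_neg (C : ℝ) {c : ℝ} (hc : 0 < c) :
    Tendsto (fun t => C * Real.exp (-c * t)) atTop (𝓝 0) := by
  have : Tendsto (fun t => Real.exp (-c * t)) atTop (𝓝 0) :=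
    Real.tendsto_exp_atBot.comp (tendsto_id.const_mul_atTop_of_neg (by linarith))
  simpa using this.const_mul C

theorem ExpDecay.tendsto {E : Type*} [SeminormedAddCommGroup E] {f : ℝ → E} (hf : ExpDecay f) :
    Tendsto f atTop (𝓝 0) := by
  obtain ⟨C, c, hC, hc, hb⟩ := hf
  refine squeeze_zero_norm' ?_ (tendsto_const_mul_exp_neg C hc)
  filter_upwards [eventually_ge_atTop 0] with t ht using hb t ht

/-- A stable scalar mode driven by an exponentially decaying input decays exponentially. -/
theorem ExpDecay.of_hasDerivWithinAt {E : Type*} [NormedAddCommGroup E] [NormedSpace ℂ E]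
    {w f : ℝ → E} {μ : ℂ} (hμ : μ.re < 0) (hf : ExpDecay f)
    (hw : ∀ t, 0 ≤ t → HasDerivWithinAt w (μ • w t + f t) (Ici 0) t) : ExpDecay w := by
  obtain ⟨C, c, hC, hc, hb⟩ := hf
  -- A rate strictly below both `c` and `-Re μ` avoids the resonant case, where the solution behaves
  -- like `t * exp (-c t)`.
  obtain ⟨d, hd0, hd⟩ := exists_between (lt_min hc (neg_pos.2 hμ))
  have hdc := hd.trans_le (min_le_left _ _)
  have hdμ := hd.trans_le (min_le_right _ _)
  set ν := -μ.re - d with hν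
  have hνpos : 0 < ν := by linarith
  set g : ℝ → E := fun t => Complex.exp (-μ * t) • w t with hg
  have hexp : ∀ t : ℝ, ‖Complex.exp (-μ * t)‖ = Real.exp (-μ.re * t) := by
    intro t; rw [Complex.norm_exp]; simp
  have hgd : ∀ t : ℝ, 0 ≤ t → HasDerivWithinAt g (Complex.exp (-μ * t) • f t) (Ici 0) t := by
    intro t ht
    have h1 : HasDerivWithinAt (fun t : ℝ => Complex.exp (-μ * t))
        (Complex.exp (-μ * t) * (-μ)) (Ici 0) t := by
      have : HasDerivAt (fun t : ℝ => -μ * (t : ℂ)) (-μ) t := by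
        simpa using (Complex.ofRealCLM.hasDerivAt (x := t)).const_mul (-μ)
      exact this.cexp.hasDerivWithinAt
    refine (h1.smul (hw t ht)).congr_deriv ?_
    module
  have hbound : ∀ t : ℝ, 0 ≤ t → ‖g t‖ ≤ ‖w 0‖ + C / ν * Real.exp (ν * t) := by
    intro t ht
    have key := image_norm_le_of_norm_deriv_right_le_deriv_boundary (a := 0) (b := t)
      (f := g) (f' := fun t => Complex.exp (-μ * t) • f t)
      (B := fun s => ‖w 0‖ + C / ν * Real.exp (ν * s)) (B' := fun s => C * Real.exp (ν * s))
      (fun s hs => (hgd s hs.1).continuousWithinAt.mono Icc_subset_Ici_self)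
      (fun s hs => (hgd s hs.1).mono (Ici_subset_Ici.2 hs.1))
      (by simp only [hg]; simp; positivity)
      (fun s => by
        have h1 : HasDerivAt (fun s : ℝ => ν * s) ν s := by
          simpa using (hasDerivAt_id s).const_mul ν
        refine ((h1.exp.const_mul (C / ν)).const_add ‖w 0‖).congr_deriv ?_
        field_simp)
      (fun s hs => by
        rw [norm_smul, hexp]
        have h2 := hb s hs.1
        calc Real.exp (-μ.re * s) * ‖f s‖ ≤ Real.exp (-μ.re * s) * (C * Real.exp (-c * s)) := by
              gcongr
          _ = C * Real.exp (-μ.re * s + -c * s) := by rw [Real.exp_add]; ring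
          _ ≤ C * Real.exp (ν * s) := by
              gcongr
              rw [hν]
              nlinarith [hs.1])
    exact key ⟨ht, le_rfl⟩
  refine ⟨‖w 0‖ + C / ν, d, by positivity, hd0, fun t ht => ?_⟩
  have h1 := hbound t ht
  rw [hg] at h1
  simp only [norm_smul, hexp] at h1
  have h2 : ‖w t‖ = Real.exp (μ.re * t) * (Real.exp (-μ.re * t) * ‖w t‖) := by
    rw [← mul_assoc, ← Real.exp_add]; simp
  rw [h2]
  calc _ ≤ Real.exp (μ.re * t) * (‖w 0‖ + C / ν * Real.exp (ν * t)) := by gcongr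
    _ = ‖w 0‖ * Real.exp (μ.re * t) + C / ν * Real.exp (μ.re * t + ν * t) := by
        rw [Real.exp_add]; ring
    _ ≤ ‖w 0‖ * Real.exp (-d * t) + C / ν * Real.exp (-d * t) := by
        gcongr
        · linarith
        · rw [hν]; nlinarith
    _ = _ := by ring

/-- Real scalar version. -/
theorem ExpDecay.of_hasDerivWithinAt_real {w f : ℝ → ℝ} {a : ℝ} (ha : 0 < a) (hf : ExpDecay f)
    (hw : ∀ t, 0 ≤ t → HasDerivWithinAt w (-a * w t + f t) (Ici 0) t) : ExpDecay w := by
  have h1 : ExpDecay (fun t => (f t : ℂ)) := hf.of_norm_le 1 zero_le_one (by simp)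
  have h2 : ExpDecay (fun t => (w t : ℂ)) := by
    refine ExpDecay.of_hasDerivWithinAt (μ := ((-a : ℝ) : ℂ)) (by simpa using ha) h1 ?_
    intro t ht
    simpa using (hw t ht).ofReal_comp
  exact h2.of_norm_le 1 zero_le_one (by simp)

theorem HasDerivWithinAt.matrix_mulVec {n : ℕ} {𝕜 : Type*} [NormedField 𝕜] [NormedAlgebra ℝ 𝕜]
    (B : Matrix (Fin n) (Fin n) 𝕜) {w : ℝ → Fin n → 𝕜} {w' : Fin n → 𝕜} {s : Set ℝ} {t : ℝ}
    (hw : HasDerivWithinAt w w' s t) :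
    HasDerivWithinAt (fun t => B.mulVec (w t)) (B.mulVec w') s t := by
  rw [hasDerivWithinAt_pi] at hw ⊢
  intro i
  simp only [Matrix.mulVec, dotProduct]
  exact HasDerivWithinAt.fun_sum fun j _ => (hw j).const_mul (B i j)

/-- Peeling off one linear factor at a time replaces Jordan forms and matrix exponentials: `(B - a)
w` solves the same system and decays by induction, and `w' = a w + (B - a) w` is then a stable
scalar mode with decaying input. -/
theorem expDecay_of_aeval {n : ℕ} (B : Matrix (Fin n) (Fin n) ℂ) (s : Multiset ℂ)
    (hs : ∀ μ ∈ s, μ.re < 0) (w : ℝ → Fin n → ℂ)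
    (hw : ∀ t, 0 ≤ t → HasDerivWithinAt w (B.mulVec (w t)) (Ici 0) t)
    (hd : ExpDecay fun t =>
      (Polynomial.aeval B (s.map fun μ => Polynomial.X - Polynomial.C μ).prod).mulVec (w t)) :
    ExpDecay w := by
  induction s using Multiset.induction_on generalizing w with
  | empty => simpa using hd
  | cons a s ih =>
    have h1 : ExpDecay (fun t => (B - algebraMap ℂ _ a).mulVec (w t)) := by
      refine ih (fun μ hμ => hs μ (Multiset.mem_cons_of_mem hμ)) _ (fun t ht => ?_) ?_
      · refine (HasDerivWithinAt.matrix_mulVec (B - algebraMap ℂ _ a) (hw t ht)).congr_deriv ?_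
        rw [Matrix.mulVec_mulVec, Matrix.mulVec_mulVec, mul_sub, sub_mul,
          (Algebra.commutes a B)]
      · refine hd.of_norm_le 1 zero_le_one fun t _ => ?_
        rw [one_mul, Matrix.mulVec_mulVec, Multiset.map_cons, Multiset.prod_cons, mul_comm,
          map_mul, map_sub, Polynomial.aeval_X, Polynomial.aeval_C]
    refine ExpDecay.of_hasDerivWithinAt (hs a (Multiset.mem_cons_self a s)) h1 fun t ht => ?_
    refine (hw t ht).congr_deriv ?_
    rw [Matrix.sub_mulVec, Algebra.algebraMap_eq_smul_one, Matrix.smul_mulVec, Matrix.one_mulVec]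
    abel

/-- Solutions of a linear system with a Hurwitz matrix decay exponentially. -/
theorem IsHurwitz.expDecay {n : ℕ} {A : Matrix (Fin n) (Fin n) ℝ} (hA : IsHurwitz A)
    {w : ℝ → Fin n → ℝ}
    (hw : ∀ t, 0 ≤ t → HasDerivWithinAt w (A.mulVec (w t)) (Ici 0) t) : ExpDecay w := by
  set B := A.map (algebraMap ℝ ℂ) with hB
  set W : ℝ → Fin n → ℂ := fun t i => (w t i : ℂ) with hWdef
  have hW : ∀ t, 0 ≤ t → HasDerivWithinAt W (B.mulVec (W t)) (Ici 0) t := by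
    intro t ht
    rw [hasDerivWithinAt_pi]
    intro i
    refine (hasDerivWithinAt_pi.1 (hw t ht) i).ofReal_comp.congr_deriv ?_
    simp [Matrix.mulVec, dotProduct, hB, hWdef]
  have hsplit := IsAlgClosed.splits B.charpoly
  have hprod : (B.charpoly.roots.map fun μ => Polynomial.X - Polynomial.C μ).prod = B.charpoly :=
    (hsplit.eq_prod_roots_of_monic B.charpoly_monic).symm
  have hWd : ExpDecay W := by
    refine expDecay_of_aeval B B.charpoly.roots (fun μ hμ => hA μ ?_) W hW ?_
    · exact Matrix.mem_spectrum_of_isRoot_charpoly (Polynomial.isRoot_of_mem_roots hμ)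
    -- By Cayley–Hamilton the product over all the roots annihilates `W`.
    · rw [hprod, Matrix.aeval_self_charpoly]
      exact ⟨0, 1, le_rfl, one_pos, by simp⟩
  refine hWd.of_norm_le 1 zero_le_one fun t _ => ?_
  rw [one_mul, pi_norm_le_iff_of_nonneg (norm_nonneg _)]
  intro i
  simpa [hWdef] using norm_le_pi_norm (W t) i

/-! ### Boundedness and lemmas of Barbalat type. -/

/-- A continuous function on a half-line that has a limit is bounded. -/
theorem bounded_of_tendsto {f : ℝ → ℝ} {l : ℝ} (hc : ContinuousOn f (Ici 0))
    (hl : Tendsto f atTop (𝓝 l)) : ∃ M, ∀ t, 0 ≤ t → |f t| ≤ M := by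
  have h1 : ∀ᶠ t in atTop, |f t| < |l| + 1 :=
    hl.abs.eventually (gt_mem_nhds (lt_add_one _))
  obtain ⟨T, hT⟩ := eventually_atTop.1 h1
  obtain ⟨M, hM⟩ := (isCompact_Icc (a := 0) (b := T)).exists_bound_of_continuousOn
    (hc.mono Icc_subset_Ici_self)
  refine ⟨max M (|l| + 1), fun t ht => ?_⟩
  rcases le_total t T with h | h
  · exact (hM t ⟨ht, h⟩).trans (le_max_left _ _)
  · exact (hT t h).le.trans (le_max_right _ _)

/-- A stable scalar equation with bounded input has bounded solutions. -/
theorem bounded_of_hasDerivWithinAt {w f : ℝ → ℝ} {a M : ℝ} (ha : 0 < a)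
    (hf : ∀ t, 0 ≤ t → |f t| ≤ M)
    (hw : ∀ t, 0 ≤ t → HasDerivWithinAt w (-a * w t + f t) (Ici 0) t) :
    ∃ K, ∀ t, 0 ≤ t → |w t| ≤ K := by
  have hM : 0 ≤ M := (abs_nonneg _).trans (hf 0 le_rfl)
  refine ⟨|w 0| + M / a, fun t ht => ?_⟩
  have key := image_norm_le_of_norm_deriv_right_le_deriv_boundary (a := 0) (b := t)
      (f := fun s => Real.exp (a * s) * w s) (f' := fun s => Real.exp (a * s) * f s)
      (B := fun s => |w 0| + M / a * Real.exp (a * s)) (B' := fun s => M * Real.exp (a * s))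
      (fun s hs => (by fun_prop : Continuous fun s => Real.exp (a * s)).continuousWithinAt.mul
        ((hw s hs.1).continuousWithinAt.mono Icc_subset_Ici_self))
      (fun s hs => by
        have h1 : HasDerivAt (fun s : ℝ => a * s) a s := by
          simpa using (hasDerivAt_id s).const_mul a
        have := h1.exp.hasDerivWithinAt.mul ((hw s hs.1).mono (Ici_subset_Ici.2 hs.1))
        exact this.congr_deriv (by ring))
      (by simp; positivity)
      (fun s => by
        have h1 : HasDerivAt (fun s : ℝ => a * s) a s := by
          simpa using (hasDerivAt_id s).const_mul a
        refine ((h1.exp.const_mul (M / a)).const_add |w 0|).congr_deriv ?_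
        field_simp)
      (fun s hs => by
        rw [norm_mul, Real.norm_eq_abs, Real.abs_exp, mul_comm]
        exact mul_le_mul_of_nonneg_right (hf s hs.1) (Real.exp_pos _).le)
  have h1 := key (right_mem_Icc.2 ht)
  simp only [norm_mul, Real.norm_eq_abs, Real.abs_exp] at h1
  have h2 : 1 ≤ Real.exp (a * t) := Real.one_le_exp (by positivity)
  have h3 : Real.exp (a * t) * |w t| ≤ Real.exp (a * t) * (|w 0| + M / a) := by
    nlinarith [abs_nonneg (w 0)]
  exact le_of_mul_le_mul_left h3 (Real.exp_pos _)

/-- The difference quotients of `f` over a fixed step tend to zero and are values of `d` at nearby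
points; `d` is Lipschitz, so it cannot differ much from them. -/
theorem tendsto_deriv_zero_of_bounded {f d d' : ℝ → ℝ} {l M : ℝ}
    (hl : Tendsto f atTop (𝓝 l))
    (hf : ∀ t, 0 ≤ t → HasDerivWithinAt f (d t) (Ici 0) t)
    (hd : ∀ t, 0 ≤ t → HasDerivWithinAt d (d' t) (Ici 0) t)
    (hM : ∀ t, 0 ≤ t → |d' t| ≤ M) : Tendsto d atTop (𝓝 0) := by
  have hM0 : 0 ≤ M := (abs_nonneg _).trans (hM 0 le_rfl)
  have hlip : ∀ s t, 0 ≤ s → 0 ≤ t → |d t - d s| ≤ M * |t - s| := fun s t hs ht =>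
    (convex_Ici 0).norm_image_sub_le_of_norm_hasDerivWithin_le hd hM hs ht
  rw [Metric.tendsto_nhds]
  intro ε hε
  -- Over a step of this length `d` varies by at most `ε / 2`; the `+ 1` covers `M = 0`.
  set h := ε / (2 * (M + 1)) with hh
  have hpos : 0 < h := by positivity
  have hdiff : Tendsto (fun t => (f (t + h) - f t) / h) atTop (𝓝 0) := by
    have := ((hl.comp (tendsto_atTop_add_const_right _ h tendsto_id)).sub hl).div_const h
    simpa using this
  filter_upwards [eventually_ge_atTop 0, (Metric.tendsto_nhds.1 hdiff) (ε / 2) (by positivity)]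
    with t ht h1
  obtain ⟨ξ, hξ, hξe⟩ := exists_hasDerivAt_eq_slope f d (show t < t + h by linarith)
    (fun s hs => ((hf s (ht.trans hs.1)).continuousWithinAt.mono
      (fun u hu => ht.trans hu.1)))
    (fun s hs => (hf s (ht.trans hs.1.le)).hasDerivAt (Ici_mem_nhds (ht.trans_lt hs.1)))
  rw [add_sub_cancel_left] at hξe
  rw [← hξe] at h1
  rw [Real.dist_eq, sub_zero] at h1 ⊢
  have h2 := hlip ξ t (ht.trans hξ.1.le) ht
  have h3 : |t - ξ| ≤ h := by
    rw [abs_le]; constructor <;> linarith [hξ.1, hξ.2]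
  have h4 : M * |t - ξ| ≤ ε / 2 := by
    calc M * |t - ξ| ≤ (M + 1) * h := by gcongr; linarith
      _ = ε / 2 := by rw [hh]; field_simp
  calc |d t| = |d ξ + (d t - d ξ)| := by ring_nf
    _ ≤ |d ξ| + |d t - d ξ| := abs_add_le _ _
    _ < ε := by linarith

/-- Barbalat's lemma for a square-integrable bounded function with bounded derivative. -/
theorem tendsto_zero_of_sq_integrable {f d : ℝ → ℝ} {M B : ℝ}
    (hf : ∀ t, 0 ≤ t → HasDerivWithinAt f (d t) (Ici 0) t)
    (hM : ∀ t, 0 ≤ t → |d t| ≤ M) (hB : ∀ t, 0 ≤ t → |f t| ≤ B)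
    (hi : IntegrableOn (fun t => f t ^ 2) (Ioi 0)) : Tendsto f atTop (𝓝 0) := by
  have hat : ∀ t, 0 < t → HasDerivAt f (d t) t := fun t ht =>
    (hf t ht.le).hasDerivAt (Ici_mem_nhds ht)
  have hcont : ContinuousOn f (Ioi 0) := fun t ht => (hat t ht).continuousAt.continuousWithinAt
  -- The cube and its derivative `3 f² d` are both integrable, being `f²` times bounded functions,
  -- so the cube tends to zero.
  have h3 : ∀ t ∈ Ioi (0 : ℝ), HasDerivAt (fun t => f t ^ 3) (f t ^ 2 * (3 * d t)) t := by
    intro t ht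
    refine ((hat t ht).pow 3).congr_deriv ?_
    norm_num
    ring
  -- Measurability of `d` is not assumed; it is inherited from `deriv f`.
  have hmeas : AEStronglyMeasurable (fun t => 3 * d t) (volume.restrict (Ioi 0)) := by
    refine AEStronglyMeasurable.congr
      (f := fun t => 3 * deriv f t) ((measurable_deriv f).const_mul 3).aestronglyMeasurable ?_
    filter_upwards [ae_restrict_mem measurableSet_Ioi] with t ht
    rw [(hat t ht).deriv]
  have hi' : IntegrableOn (fun t => f t ^ 2 * (3 * d t)) (Ioi 0) := by
    refine Integrable.mul_bdd (c := 3 * M) hi hmeas ?_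
    filter_upwards [ae_restrict_mem measurableSet_Ioi] with t ht
    rw [norm_mul, Real.norm_eq_abs, Real.norm_eq_abs, abs_of_pos (by norm_num : (0 : ℝ) < 3)]
    linarith [hM t (le_of_lt ht)]
  have hi3 : IntegrableOn (fun t => f t ^ 3) (Ioi 0) := by
    have : IntegrableOn (fun t => f t ^ 2 * f t) (Ioi 0) := by
      refine Integrable.mul_bdd (c := B) hi (hcont.aestronglyMeasurable measurableSet_Ioi) ?_
      filter_upwards [ae_restrict_mem measurableSet_Ioi] with t ht using hB t (le_of_lt ht)
    exact this.congr_fun (fun t _ => by ring) measurableSet_Ioi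
  have h0 := tendsto_zero_of_hasDerivAt_of_integrableOn_Ioi h3 hi' hi3
  rw [Metric.tendsto_nhds] at h0 ⊢
  intro ε hε
  filter_upwards [h0 (ε ^ 3) (by positivity)] with t ht
  rw [Real.dist_eq, sub_zero] at ht ⊢
  rw [abs_pow] at ht
  exact lt_of_pow_lt_pow_left₀ 3 hε.le ht

/-- Exponential decay of the physical states of one linear current loop. -/
theorem LoopGains.Proper.expDecay {k : LoopGains} {R C : ℝ} (hk : k.Proper R C)
    {e a f b : ℝ → ℝ}
    (he : ∀ t, 0 ≤ t → HasDerivWithinAt e (-(1 / (R * C)) * e t - 1 / C * f t) (Ici 0) t)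
    (ha : ∀ t, 0 ≤ t → HasDerivWithinAt a (k.kvInt * e t) (Ici 0) t)
    (hf : ∀ t, 0 ≤ t → HasDerivWithinAt f
      (((k.ki - k.kv) * (C * k.kv - 1 / R) + C * k.kvBar * k.kvInt) * e t
        + k.kvBar * (k.ki * C - k.kv * C + 1 / R) * a t - k.ki * f t - k.kiBar * b t) (Ici 0) t)
    (hb : ∀ t, 0 ≤ t → HasDerivWithinAt b
      (k.kiInt * (1 / R - C * k.kv) * e t - k.kiInt * C * k.kvBar * a t + k.kiInt * f t)
      (Ici 0) t) :
    ExpDecay e ∧ ExpDecay f := by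
  obtain ⟨-, -, ⟨-, -, -, -, hH⟩ | ⟨h1, h2, h3, h4, hH⟩⟩ := hk
  · have hw : ExpDecay (fun t => ![e t, a t, f t, b t]) := by
      refine hH.expDecay fun t ht => ?_
      rw [hasDerivWithinAt_pi]
      intro i
      fin_cases i
      · refine (he t ht).congr_deriv ?_
        simp [loopMatrix, Matrix.mulVec, dotProduct, Fin.sum_univ_four]; ring
      · refine (ha t ht).congr_deriv ?_
        simp [loopMatrix, Matrix.mulVec, dotProduct, Fin.sum_univ_four]
      · refine (hf t ht).congr_deriv ?_
        simp [loopMatrix, Matrix.mulVec, dotProduct, Fin.sum_univ_four]; ring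
      · refine (hb t ht).congr_deriv ?_
        simp [loopMatrix, Matrix.mulVec, dotProduct, Fin.sum_univ_four]; ring
    refine ⟨hw.of_norm_le 1 zero_le_one fun t _ => ?_, hw.of_norm_le 1 zero_le_one fun t _ => ?_⟩
    · rw [one_mul]; exact norm_le_pi_norm ![e t, a t, f t, b t] 0
    · rw [one_mul]; exact norm_le_pi_norm ![e t, a t, f t, b t] 2
  -- With `kvBar` and `kiBar` zero, the integrator states no longer enter the equations of `e` and
  -- `f`.
  · have hw : ExpDecay (fun t => ![e t, f t]) := by
      refine hH.expDecay fun t ht => ?_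
      rw [hasDerivWithinAt_pi]
      intro i
      fin_cases i
      · refine (he t ht).congr_deriv ?_
        simp [loopMatrix, Matrix.mulVec, dotProduct, Fin.sum_univ_two]; ring
      · refine (hf t ht).congr_deriv ?_
        simp [loopMatrix, Matrix.mulVec, dotProduct, Fin.sum_univ_two, h1, h3]; ring
    refine ⟨hw.of_norm_le 1 zero_le_one fun t _ => ?_, hw.of_norm_le 1 zero_le_one fun t _ => ?_⟩
    · rw [one_mul]; exact norm_le_pi_norm ![e t, f t] 0
    · rw [one_mul]; exact norm_le_pi_norm ![e t, f t] 1

/-! ### Energy estimates under a decaying perturbation. -/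

theorem hasDerivAt_exp_neg (K : ℝ) {c : ℝ} (hc : 0 < c) (t : ℝ) :
    HasDerivAt (fun t => K / c * Real.exp (-c * t)) (-(K * Real.exp (-c * t))) t := by
  have h1 : HasDerivAt (fun s : ℝ => -c * s) (-c) t := by
    simpa using (hasDerivAt_id t).const_mul (-c)
  refine (h1.exp.const_mul (K / c)).congr_deriv ?_
  field_simp

/-- A positive function whose growth rate decays exponentially is bounded. -/
theorem bounded_of_deriv_le_exp_mul {W W' : ℝ → ℝ} {N c : ℝ} (hN : 0 ≤ N) (hc : 0 < c)
    (hpos : ∀ t, 0 ≤ t → 0 ≤ W t)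
    (hW : ∀ t, 0 ≤ t → HasDerivWithinAt W (W' t) (Ici 0) t)
    (hle : ∀ t, 0 ≤ t → W' t ≤ N * Real.exp (-c * t) * W t) :
    ∀ t, 0 ≤ t → W t ≤ W 0 * Real.exp (N / c) := by
  -- An integrating factor with `E' = -N exp (-c t) E`; it is at least `1` and starts at `exp (N /
  -- c)`.
  set E : ℝ → ℝ := fun t => Real.exp (N / c * Real.exp (-c * t)) with hE
  have hd : ∀ t, 0 ≤ t → HasDerivWithinAt (fun t => W t * E t)
      ((W' t - N * Real.exp (-c * t) * W t) * E t) (Ici 0) t := by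
    intro t ht
    refine ((hW t ht).mul (hasDerivAt_exp_neg N hc t).exp.hasDerivWithinAt).congr_deriv ?_
    simp only [hE]; ring
  have hanti : AntitoneOn (fun t => W t * E t) (Ici 0) := by
    refine antitoneOn_of_hasDerivWithinAt_nonpos (convex_Ici 0)
      (fun t ht => (hd t ht).continuousWithinAt)
      (fun t ht => (hd t (interior_subset ht)).mono interior_subset) fun t ht => ?_
    exact mul_nonpos_of_nonpos_of_nonneg (sub_nonpos.2 (hle t (interior_subset ht)))
      (Real.exp_pos _).le
  intro t ht
  have h1 := hanti (self_mem_Ici : (0 : ℝ) ∈ Ici 0) ht ht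
  simp only [hE, mul_zero, Real.exp_zero, mul_one] at h1
  refine le_trans (le_mul_of_one_le_right (hpos t ht) ?_) h1
  exact Real.one_le_exp (by positivity)

/-- Convergence from an energy balance with an exponentially decaying perturbation. -/
theorem tendsto_of_energy {y2 y5 y9 p d2 d5 d9 : ℝ → ℝ} {c2 c5 c9 q2 q5 q9 k M2 M5 r : ℝ}
    (hc2 : 0 < c2) (hc5 : 0 < c5) (hc9 : 0 < c9) (hq2 : 0 < q2) (hq5 : 0 < q5) (hq9 : 0 < q9)
    (hM2 : 0 ≤ M2) (hM5 : 0 ≤ M5)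
    (h2 : ∀ t, 0 ≤ t → HasDerivWithinAt y2 (d2 t) (Ici 0) t)
    (h5 : ∀ t, 0 ≤ t → HasDerivWithinAt y5 (d5 t) (Ici 0) t)
    (h9 : ∀ t, 0 ≤ t → HasDerivWithinAt y9 (d9 t) (Ici 0) t)
    (hE : ∀ t, 0 ≤ t → c9 * (y9 t * d9 t) + c2 * (y2 t * d2 t) + c5 * (y5 t * d5 t)
      = -(q2 * y2 t ^ 2 + q5 * y5 t ^ 2 + q9 * (y9 t - r) ^ 2) + k * y9 t * p t)
    (hp : ExpDecay p) (hne : ∀ t, 0 ≤ t → y9 t ≠ 0)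
    (hd2 : ∀ t, 0 ≤ t → |d2 t| ≤ M2 * (1 + |y2 t| + |y9 t|))
    (hd5 : ∀ t, 0 ≤ t → |d5 t| ≤ M5 * (1 + |y5 t| + |y9 t|)) :
    Tendsto y2 atTop (𝓝 0) ∧ Tendsto y5 atTop (𝓝 0) ∧ Tendsto y9 atTop (𝓝 r) := by
  obtain ⟨C, c, hC, hc, hp⟩ := hp
  set Q : ℝ → ℝ := fun t => q2 * y2 t ^ 2 + q5 * y5 t ^ 2 + q9 * (y9 t - r) ^ 2 with hQ
  -- The summand `1` makes the linear quantity `|y9|` bounded by a multiple of `W`.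
  set W : ℝ → ℝ := fun t => c9 / 2 * y9 t ^ 2 + c2 / 2 * y2 t ^ 2 + c5 / 2 * y5 t ^ 2 + 1 with hW
  have hQ0 : ∀ t, 0 ≤ Q t := fun t => by simp only [hQ]; positivity
  have hW0 : ∀ t, 0 ≤ W t := fun t => by simp only [hW]; positivity
  have hWd : ∀ t, 0 ≤ t → HasDerivWithinAt W (-Q t + k * y9 t * p t) (Ici 0) t := by
    intro t ht
    refine (((((h9 t ht).pow 2).const_mul (c9 / 2)).add (((h2 t ht).pow 2).const_mul (c2 / 2))).add
      (((h5 t ht).pow 2).const_mul (c5 / 2))).add_const 1 |>.congr_deriv ?_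
    rw [← hE t ht]; norm_num; ring
  set N := |k| * (1 + 2 / c9) * C with hN
  have hN0 : 0 ≤ N := by positivity
  have hpert : ∀ t, 0 ≤ t → |k * y9 t * p t| ≤ N * Real.exp (-c * t) * W t := by
    intro t ht
    have h1 : |y9 t| ≤ (1 + 2 / c9) * W t := by
      have ha : |y9 t| ≤ 1 + y9 t ^ 2 := by
        nlinarith [sq_abs (y9 t), sq_nonneg (|y9 t| - 1), abs_nonneg (y9 t)]
      have hb : y9 t ^ 2 = 2 / c9 * (c9 / 2 * y9 t ^ 2) := by field_simp
      have h1W : 1 ≤ W t := by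
        have : 0 ≤ c9 / 2 * y9 t ^ 2 + c2 / 2 * y2 t ^ 2 + c5 / 2 * y5 t ^ 2 := by positivity
        simp only [hW]; linarith
      have h2W : c9 / 2 * y9 t ^ 2 ≤ W t := by
        have : 0 ≤ c2 / 2 * y2 t ^ 2 + c5 / 2 * y5 t ^ 2 := by positivity
        simp only [hW]; linarith
      have := mul_le_mul_of_nonneg_left h2W (by positivity : 0 ≤ 2 / c9)
      linarith
    have h2 := hp t ht
    rw [Real.norm_eq_abs] at h2
    calc |k * y9 t * p t| = |k| * |y9 t| * |p t| := by rw [abs_mul, abs_mul]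
      _ ≤ |k| * ((1 + 2 / c9) * W t) * (C * Real.exp (-c * t)) := by
          have := hW0 t
          gcongr
      _ = _ := by rw [hN]; ring
  set B := W 0 * Real.exp (N / c) with hB
  have hB0 : 0 ≤ B := mul_nonneg (hW0 0) (Real.exp_pos _).le
  have hWB : ∀ t, 0 ≤ t → W t ≤ B :=
    bounded_of_deriv_le_exp_mul hN0 hc (fun t _ => hW0 t) hWd fun t ht => by
      linarith [hQ0 t, hpert t ht, le_abs_self (k * y9 t * p t)]
  -- the corrected energy is monotone
  set V : ℝ → ℝ := fun t => -W t - N * B / c * Real.exp (-c * t) with hV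
  have hVd : ∀ t, 0 ≤ t → HasDerivWithinAt V
      (Q t - k * y9 t * p t + N * B * Real.exp (-c * t)) (Ici 0) t := by
    intro t ht
    refine ((hWd t ht).neg.sub (hasDerivAt_exp_neg (N * B) hc t).hasDerivWithinAt).congr_deriv ?_
    ring
  have hVQ : ∀ t, 0 ≤ t → Q t ≤ Q t - k * y9 t * p t + N * B * Real.exp (-c * t) := by
    intro t ht
    have h1 := hpert t ht
    have h2 : N * Real.exp (-c * t) * W t ≤ N * Real.exp (-c * t) * B :=
      mul_le_mul_of_nonneg_left (hWB t ht) (by positivity)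
    linarith [le_abs_self (k * y9 t * p t)]
  have hVmono : MonotoneOn V (Ici 0) := by
    refine monotoneOn_of_hasDerivWithinAt_nonneg (convex_Ici 0)
      (fun t ht => (hVd t ht).continuousWithinAt)
      (fun t ht => (hVd t (interior_subset ht)).mono interior_subset) fun t ht => ?_
    exact (hQ0 t).trans (hVQ t (interior_subset ht))
  have hV0 : ∀ t, V t ≤ 0 := by
    intro t
    have : 0 ≤ N * B / c * Real.exp (-c * t) := by positivity
    simp only [hV]; linarith [hW0 t]
  obtain ⟨v, hv⟩ : ∃ v, Tendsto V atTop (𝓝 v) := by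
    have hmono : Monotone fun t => V (max t 0) := fun s t hst =>
      hVmono (mem_Ici.2 (le_max_right _ _)) (mem_Ici.2 (le_max_right _ _)) (max_le_max_right 0 hst)
    refine ⟨_, (tendsto_atTop_ciSup hmono ⟨0, ?_⟩).congr' ?_⟩
    · rintro _ ⟨t, rfl⟩; exact hV0 _
    · filter_upwards [eventually_ge_atTop 0] with t ht
      rw [max_eq_left ht]
  have hWlim : Tendsto W atTop (𝓝 (-v)) := by
    have h1 := hv.neg.sub (tendsto_const_mul_exp_neg (N * B / c) hc)
    rw [sub_zero] at h1
    refine h1.congr fun t => ?_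
    simp only [hV]; ring
  -- The nonnegative derivative of a convergent function is integrable, and by `hVQ` it dominates
  -- the dissipation `Q`.
  have hint : IntegrableOn
      (fun t => Q t - k * y9 t * p t + N * B * Real.exp (-c * t)) (Ioi 0) :=
    integrableOn_Ioi_deriv_of_nonneg (hVd 0 le_rfl).continuousWithinAt
      (fun t ht => (hVd t (le_of_lt ht)).hasDerivAt (Ici_mem_nhds ht))
      (fun t ht => (hQ0 t).trans (hVQ t (le_of_lt ht))) hv
  have hcont : ∀ {f d : ℝ → ℝ}, (∀ t, 0 ≤ t → HasDerivWithinAt f (d t) (Ici 0) t) →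
      ContinuousOn f (Ioi 0) := fun h t ht =>
    (h t (le_of_lt ht)).continuousWithinAt.mono Ioi_subset_Ici_self
  have c2' := hcont h2
  have c5' := hcont h5
  have c9' := hcont h9
  have hsq : ∀ {f : ℝ → ℝ} {q : ℝ}, 0 < q → ContinuousOn f (Ioi 0) →
      (∀ t, q * f t ^ 2 ≤ Q t) → IntegrableOn (fun t => f t ^ 2) (Ioi 0) := by
    intro f q hq hf hle
    refine Integrable.mono' (hint.const_mul (1 / q))
      ((hf.pow 2).aestronglyMeasurable measurableSet_Ioi) ?_
    filter_upwards [ae_restrict_mem measurableSet_Ioi] with t ht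
    have h1 := (hle t).trans (hVQ t (le_of_lt ht))
    rw [Real.norm_eq_abs, abs_of_nonneg (sq_nonneg _)]
    calc f t ^ 2 = 1 / q * (q * f t ^ 2) := by field_simp
      _ ≤ _ := mul_le_mul_of_nonneg_left h1 (by positivity)
  have i2 : IntegrableOn (fun t => y2 t ^ 2) (Ioi 0) := hsq hq2 c2' fun t => by
    have : 0 ≤ q5 * y5 t ^ 2 + q9 * (y9 t - r) ^ 2 := by positivity
    simp only [hQ]; linarith
  have i5 : IntegrableOn (fun t => y5 t ^ 2) (Ioi 0) := hsq hq5 c5' fun t => by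
    have : 0 ≤ q2 * y2 t ^ 2 + q9 * (y9 t - r) ^ 2 := by positivity
    simp only [hQ]; linarith
  have i9 : IntegrableOn (fun t => (y9 t - r) ^ 2) (Ioi 0) :=
    hsq hq9 (c9'.sub continuousOn_const) fun t => by
      have : 0 ≤ q2 * y2 t ^ 2 + q5 * y5 t ^ 2 := by positivity
      simp only [hQ]; linarith
  have habs : ∀ {f : ℝ → ℝ} {q : ℝ}, 0 < q → (∀ t, q / 2 * f t ^ 2 + 1 ≤ W t) →
      ∀ t, 0 ≤ t → |f t| ≤ 1 + 2 / q * B := by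
    intro f q hq hle t ht
    have h1 := (hle t).trans (hWB t ht)
    have h2 : f t ^ 2 = 2 / q * (q / 2 * f t ^ 2) := by field_simp
    have h3 : 2 / q * (q / 2 * f t ^ 2) ≤ 2 / q * B :=
      mul_le_mul_of_nonneg_left (by linarith) (by positivity)
    nlinarith [sq_abs (f t), sq_nonneg (|f t| - 1), abs_nonneg (f t)]
  have b2 := habs (f := y2) hc2 fun t => by
    have : 0 ≤ c9 / 2 * y9 t ^ 2 + c5 / 2 * y5 t ^ 2 := by positivity
    simp only [hW]; linarith
  have b5 := habs (f := y5) hc5 fun t => by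
    have : 0 ≤ c9 / 2 * y9 t ^ 2 + c2 / 2 * y2 t ^ 2 := by positivity
    simp only [hW]; linarith
  have b9 := habs (f := y9) hc9 fun t => by
    have : 0 ≤ c2 / 2 * y2 t ^ 2 + c5 / 2 * y5 t ^ 2 := by positivity
    simp only [hW]; linarith
  have t2 : Tendsto y2 atTop (𝓝 0) := tendsto_zero_of_sq_integrable h2
    (fun t ht => (hd2 t ht).trans (mul_le_mul_of_nonneg_left
      (add_le_add (add_le_add le_rfl (b2 t ht)) (b9 t ht)) hM2)) b2 i2
  have t5 : Tendsto y5 atTop (𝓝 0) := tendsto_zero_of_sq_integrable h5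
    (fun t ht => (hd5 t ht).trans (mul_le_mul_of_nonneg_left
      (add_le_add (add_le_add le_rfl (b5 t ht)) (b9 t ht)) hM5)) b5 i5
  refine ⟨t2, t5, ?_⟩
  -- With no bound on `d9` available, the limit of `y9 ^ 2` is read off from those of the energy and
  -- its other terms.
  have t9 : ∃ l, Tendsto (fun t => y9 t ^ 2) atTop (𝓝 l) := by
    refine ⟨_, ((((hWlim.sub ((t2.pow 2).const_mul (c2 / 2))).sub
      ((t5.pow 2).const_mul (c5 / 2))).sub_const 1).const_mul (2 / c9)).congr fun t => ?_⟩
    simp only [hW]; field_simp; ring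
  obtain ⟨l, hl⟩ := t9
  have habs9 : Tendsto (fun t => |y9 t|) atTop (𝓝 (√l)) :=
    (hl.sqrt).congr fun t => Real.sqrt_sq_eq_abs _
  have hC9 : ContinuousOn y9 (Ici 0) := fun t ht => (h9 t ht).continuousWithinAt
  obtain ⟨L, hL⟩ : ∃ L, Tendsto y9 atTop (𝓝 L) := by
    -- A continuous function without zeros keeps its sign, so the limit of `|y9|` yields one of
    -- `y9`.
    rcases lt_or_gt_of_ne (hne 0 le_rfl) with h0 | h0
    · refine ⟨-√l, habs9.neg.congr' ?_⟩
      filter_upwards [eventually_ge_atTop 0] with t ht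
      rw [abs_of_neg, neg_neg]
      by_contra! hcon
      obtain ⟨s, hs, hs0⟩ := (isPreconnected_Ici (a := (0 : ℝ))).intermediate_value
        self_mem_Ici ht hC9 ⟨h0.le, hcon⟩
      exact hne s hs hs0
    · refine ⟨√l, habs9.congr' ?_⟩
      filter_upwards [eventually_ge_atTop 0] with t ht
      rw [abs_of_pos]
      by_contra! hcon
      obtain ⟨s, hs, hs0⟩ := (isPreconnected_Ici (a := (0 : ℝ))).intermediate_value
        ht self_mem_Ici hC9 ⟨hcon, h0.le⟩
      exact hne s hs hs0
  -- A convergent function that is integrable near infinity has limit zero.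
  have hz : (L - r) ^ 2 = 0 := by
    refine IntegrableAtFilter.eq_zero_of_tendsto (μ := volume) (l := atTop)
      ⟨Ioi 0, Ioi_mem_atTop 0, i9⟩ ?_ ((hL.sub_const r).pow 2)
    intro s hs
    obtain ⟨T, hT⟩ := mem_atTop_sets.1 hs
    exact top_unique ((Real.volume_Ici (a := T)).symm.le.trans (measure_mono hT))
  have : L = r := by
    have := pow_eq_zero_iff (two_ne_zero) |>.1 hz
    linarith
  rwa [this] at hL

/-! ### Regularity of the laws and independence of `x₈`. -/

theorem fderiv_apply_eq_zero_of_translation {E : Type*} [NormedAddCommGroup E] [NormedSpace ℝ E]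
    {φ : E → ℝ} {v s : E} (h : ∀ c : ℝ, φ (s + c • v) = φ s) (hd : DifferentiableAt ℝ φ s) :
    fderiv ℝ φ s v = 0 := by
  have h1 := hd.hasFDerivAt.hasLineDerivAt v
  have h2 : HasLineDerivAt ℝ φ 0 s v := by
    simp only [HasLineDerivAt, h]
    exact hasDerivAt_const _ _
  exact h1.unique h2

theorem fderiv_add_eq_of_translation {E : Type*} [NormedAddCommGroup E] [NormedSpace ℝ E]
    {φ : E → ℝ} {v : E} (h : ∀ s, φ (s + v) = φ s) (s : E) :
    fderiv ℝ φ (s + v) = fderiv ℝ φ s := by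
  rw [← fderiv_comp_add_right]
  simp only [h]

/-- The unit vector of a plant coordinate. -/
def unitVec (i : Fin 9) : State := (Pi.single i 1, 0)

variable {m : Params} {RL : ℝ} {g : Gains} {r : Refs}

theorem contDiffAt_u1 {s : State} (hs : s ∈ domain m) (n : WithTop ℕ∞) :
    ContDiffAt ℝ n (u1 m g r) s := by
  have h := hs.1
  unfold u1 v1 z3
  fun_prop (disch := exact h)

theorem contDiffAt_u2 {s : State} (hs : s ∈ domain m) (n : WithTop ℕ∞) :
    ContDiffAt ℝ n (u2 m g r) s := by
  have h := hs.2.1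
  unfold u2 v2 z6
  fun_prop (disch := exact h)

theorem contDiffAt_z7 {s : State} (hs : s ∈ domain m) (n : WithTop ℕ∞) :
    ContDiffAt ℝ n (z7 m RL g r) s := by
  have h := hs.2.2
  have h1 := contDiffAt_u1 (g := g) (r := r) hs n
  have h2 := contDiffAt_u2 (g := g) (r := r) hs n
  unfold z7
  fun_prop (disch := exact h)

theorem contDiffAt_partialField {s : State} (hs : s ∈ domain m) (n : WithTop ℕ∞) :
    ContDiffAt ℝ n (fun s => partialField m RL g r s 0) s := by
  have h1 := contDiffAt_u1 (g := g) (r := r) hs n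
  have h2 := contDiffAt_u2 (g := g) (r := r) hs n
  unfold partialField plant z3 z6
  refine ContDiffAt.prodMk (contDiffAt_pi.2 fun i => ?_) (contDiffAt_pi.2 fun i => ?_)
  · fin_cases i <;> simp <;> fun_prop
  · fin_cases i <;> simp <;> fun_prop

theorem differentiableAt_z7 {s : State} (hs : s ∈ domain m) :
    DifferentiableAt ℝ (z7 m RL g r) s :=
  (contDiffAt_z7 hs 1).differentiableAt one_ne_zero

theorem differentiableAt_z7Dot {s : State} (hs : s ∈ domain m) :
    DifferentiableAt ℝ (z7Dot m RL g r) s := by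
  have h1 : ContDiffAt ℝ 1 (fderiv ℝ (z7 m RL g r)) s :=
    (contDiffAt_z7 hs 2).fderiv_right (by norm_num)
  exact (h1.clm_apply (contDiffAt_partialField hs 1)).differentiableAt one_ne_zero

theorem z7_add_unitVec {i : Fin 9} (hi : i = 6 ∨ i = 7) (s : State) (c : ℝ) :
    z7 m RL g r (s + c • unitVec i) = z7 m RL g r s := by
  rcases hi with rfl | rfl <;>
  simp [z7, u1, u2, v1, v2, z3, z6, unitVec, State.x1, State.x2, State.x3, State.x4, State.x5,
    State.x6, State.x9, State.al1, State.al3, State.al4, State.al6]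

/-- A shift of `x₈` changes the field only in the directions of `x₇` and `x₈`, on which `z7` does
not depend. -/
theorem partialField_add_unitVec (s : State) (c : ℝ) :
    partialField m RL g r (s + c • unitVec 7) 0 = partialField m RL g r s 0
      + ((-(c / m.C7)) • unitVec 6 + (-(m.R08 / m.L8 * c)) • unitVec 7) := by
  refine Prod.ext (funext fun i => ?_) (funext fun i => ?_)
  · simp only [Prod.fst_add, Pi.add_apply, Prod.smul_fst, Pi.smul_apply]
    fin_cases i <;>
    simp [partialField, plant, u1, u2, v1, v2, z3, z6, unitVec, State.x1, State.x2, State.x3,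
      State.x4, State.x5, State.x6, State.x7, State.x8, State.x9, State.al1, State.al3, State.al4,
      State.al6] <;> try ring
  · fin_cases i <;>
    simp [partialField, z3, z6, unitVec, State.x1, State.x3, State.x4, State.x6, State.al1,
      State.al4]

/-- This makes the second time derivative of `z7` legitimate: `u3` acts on `x₈` alone and hence does
not appear in it. -/
theorem z7Dot_add_unitVec {s : State} (hs : s ∈ domain m) (c : ℝ) :
    z7Dot m RL g r (s + c • unitVec 7) = z7Dot m RL g r s := by
  have h6 : fderiv ℝ (z7 m RL g r) s (unitVec 6) = 0 :=
    fderiv_apply_eq_zero_of_translation (fun c => z7_add_unitVec (.inl rfl) s c)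
      (differentiableAt_z7 hs)
  have h7 : fderiv ℝ (z7 m RL g r) s (unitVec 7) = 0 :=
    fderiv_apply_eq_zero_of_translation (fun c => z7_add_unitVec (.inr rfl) s c)
      (differentiableAt_z7 hs)
  unfold z7Dot timeDeriv
  rw [fderiv_add_eq_of_translation (fun s => z7_add_unitVec (.inr rfl) s c),
    partialField_add_unitVec, map_add, map_add, map_smul, map_smul, h6, h7]
  simp

theorem partialField_eq_add (s : State) (w : ℝ) :
    partialField m RL g r s w = partialField m RL g r s 0 + (1 / m.L8 * m.VS * w) • unitVec 7 := by
  refine Prod.ext (funext fun i => ?_) (funext fun i => ?_)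
  · simp only [Prod.fst_add, Pi.add_apply, Prod.smul_fst, Pi.smul_apply]
    fin_cases i <;> simp [partialField, plant, unitVec]
    ring
  · simp [partialField, unitVec]

/-- The chain rule along a trajectory, for functions that do not depend on `x₈`. -/
theorem IsTrajectory.hasDerivWithinAt_comp {z : ℝ → State} (hz : IsTrajectory m RL g r z)
    {φ : State → ℝ} {t : ℝ} (ht : 0 ≤ t) (hd : DifferentiableAt ℝ φ (z t))
    (hφ : ∀ c : ℝ, φ (z t + c • unitVec 7) = φ (z t)) :
    HasDerivWithinAt (fun t => φ (z t)) (timeDeriv m RL g r φ (z t)) (Ici 0) t := by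
  refine (hd.hasFDerivAt.comp_hasDerivWithinAt t (hz t ht).2).congr_deriv ?_
  rw [closedLoop, partialField_eq_add, map_add, map_smul,
    fderiv_apply_eq_zero_of_translation hφ hd, smul_zero, add_zero, timeDeriv]

/-! ### Bounds from duty cycles in `[0, 1]`. -/

/-- Boundedness on the half-line `[0, ∞)`. -/
def BddOnHalfLine (f : ℝ → ℝ) : Prop := ∃ M, ∀ t, 0 ≤ t → |f t| ≤ M

theorem BddOnHalfLine.add {f h : ℝ → ℝ} (hf : BddOnHalfLine f) (hh : BddOnHalfLine h) :
    BddOnHalfLine fun t => f t + h t := by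
  obtain ⟨M, hM⟩ := hf
  obtain ⟨N, hN⟩ := hh
  exact ⟨M + N, fun t ht => (abs_add_le _ _).trans (add_le_add (hM t ht) (hN t ht))⟩

theorem BddOnHalfLine.const_mul {f : ℝ → ℝ} (hf : BddOnHalfLine f) (c : ℝ) :
    BddOnHalfLine fun t => c * f t := by
  obtain ⟨M, hM⟩ := hf
  refine ⟨|c| * M, fun t ht => ?_⟩
  rw [abs_mul]
  exact mul_le_mul_of_nonneg_left (hM t ht) (abs_nonneg c)

theorem BddOnHalfLine.sub {f h : ℝ → ℝ} (hf : BddOnHalfLine f) (hh : BddOnHalfLine h) :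
    BddOnHalfLine fun t => f t - h t := by
  simpa [sub_eq_add_neg] using hf.add (hh.const_mul (-1))

theorem tendsto_mul_zero_of_mem_Icc {f u : ℝ → ℝ} (hf : Tendsto f atTop (𝓝 0))
    (hu : ∀ t, 0 ≤ t → u t ∈ Icc (0 : ℝ) 1) :
    Tendsto (fun t => f t * (1 - u t)) atTop (𝓝 0) := by
  refine squeeze_zero_norm' (a := fun t => ‖f t‖) ?_ (by simpa using hf.norm)
  filter_upwards [eventually_ge_atTop 0] with t ht
  rw [norm_mul]
  refine mul_le_of_le_one_right (norm_nonneg _) ?_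
  rw [Real.norm_eq_abs, abs_le]
  constructor <;> linarith [(hu t ht).1, (hu t ht).2]

/-- The duty bound keeps the switched current below `B`, and the rest is affine. This supplies the
growth bounds on `d2` and `d5` in `tendsto_of_energy`. -/
theorem abs_capacitor_le {R C B x y z i v : ℝ} (hR : 0 < R) (hC : 0 < C) (hi : |i| ≤ B)
    (hv : v ∈ Icc (0 : ℝ) 1) :
    |-(1 / (R * C)) * x + 1 / C * i - 1 / C * v * i + 1 / (R * C) * z|
      ≤ (1 / (R * C) * (1 + |y|) + 1 / C * B) * (1 + |x - y| + |z|) := by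
  have hB : 0 ≤ B := (abs_nonneg _).trans hi
  have h1 : |x| ≤ |x - y| + |y| := by simpa using abs_add_le (x - y) y
  have h2 : |(1 - v) * i| ≤ B := by
    rw [abs_mul, abs_of_nonneg (by linarith [hv.2])]
    nlinarith [hv.1, hv.2, abs_nonneg i]
  have e : -(1 / (R * C)) * x + 1 / C * i - 1 / C * v * i + 1 / (R * C) * z
      = -(1 / (R * C) * x) + 1 / C * ((1 - v) * i) + 1 / (R * C) * z := by ring
  have hp : 0 < 1 / (R * C) := by positivity
  have hq : 0 < 1 / C := by positivity
  rw [e]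
  generalize 1 / (R * C) = p at *
  generalize 1 / C = q at *
  calc _ ≤ |-(p * x)| + |q * ((1 - v) * i)| + |p * z| := abs_add_three _ _ _
    _ = p * |x| + q * |(1 - v) * i| + p * |z| := by
        rw [abs_neg, abs_mul, abs_mul q, abs_mul p z, abs_of_pos hp, abs_of_pos hq]
    _ ≤ p * (|x - y| + |y|) + q * B + p * |z| := by gcongr
    _ ≤ _ := by
        have := mul_nonneg hq.le hB
        have := mul_nonneg hp.le (abs_nonneg y)
        nlinarith [abs_nonneg (x - y), abs_nonneg z,
          mul_nonneg (add_nonneg ‹0 ≤ q * B› ‹0 ≤ p * |y|›)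
            (add_nonneg (abs_nonneg (x - y)) (abs_nonneg z))]

/-! ### Error dynamics along a trajectory. -/

variable {m : Params} {RL : ℝ} {g : Gains} {r : Refs} {z : ℝ → State}

theorem IsTrajectory.hasDerivWithinAt_fst (hz : IsTrajectory m RL g r z) (i : Fin 9) {t : ℝ}
    (ht : 0 ≤ t) :
    HasDerivWithinAt (fun t => (z t).1 i) ((closedLoop m RL g r (z t)).1 i) (Ici 0) t :=
  hasDerivWithinAt_pi.1 (hz t ht).2.fst i

theorem IsTrajectory.hasDerivWithinAt_snd (hz : IsTrajectory m RL g r z) (i : Fin 4) {t : ℝ}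
    (ht : 0 ≤ t) :
    HasDerivWithinAt (fun t => (z t).2 i) ((closedLoop m RL g r (z t)).2 i) (Ici 0) t :=
  hasDerivWithinAt_pi.1 (hz t ht).2.snd i

/-- Feedback linearization: `u1` divides by its own coefficient in the current equation, which is
nonzero on the domain. -/
theorem closedLoop_x3 (hm : m.Positive) {s : State} (hs : s ∈ domain m) :
    (closedLoop m RL g r s).1 2 = -v1 m g r s := by
  have h : s.x2 + (m.R01 - m.R02) * s.x3 ≠ 0 := hs.1
  have hL := hm.L3.ne'
  change 1 / m.L3 * (s.x1 - s.x2 - m.R01 * s.x3)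
      + 1 / m.L3 * (s.x2 + (m.R01 - m.R02) * s.x3) * u1 m g r s = _
  unfold u1
  generalize s.x2 + (m.R01 - m.R02) * s.x3 = D at *
  field_simp
  ring

theorem closedLoop_x6 (hm : m.Positive) {s : State} (hs : s ∈ domain m) :
    (closedLoop m RL g r s).1 5 = v2 m g r s := by
  have h : s.x5 ≠ 0 := hs.2.1
  have hL := hm.L6.ne'
  change 1 / m.L6 * s.x4 - 1 / m.L6 * s.x5 - m.R04 / m.L6 * s.x6 + 1 / m.L6 * s.x5 * u2 m g r s = _
  unfold u2
  field_simp
  ring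

/-- Once the current obeys `ẋ₃ = -v1`, the deviations from the equilibrium with zero integrator
states satisfy exactly the system of `loopMatrix`. -/
theorem IsTrajectory.expDecay_pv (hm : m.Positive) (hg : g.Proper m)
    (hz : IsTrajectory m RL g r z) :
    ExpDecay (fun t => (z t).x1 - r.x1) ∧
      ExpDecay (fun t => (z t).x3 - 1 / m.R1 * (m.VPV - r.x1)) := by
  have hR := hm.R1.ne'
  have hC := hm.C1.ne'
  refine hg.1.expDecay (a := fun t => (z t).al1) (b := fun t => (z t).al3) (fun t ht => ?_)
    (fun t ht => hz.hasDerivWithinAt_snd 0 ht) (fun t ht => ?_) (fun t ht => ?_)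
  · refine ((hz.hasDerivWithinAt_fst 0 ht).sub_const r.x1).congr_deriv ?_
    change -(1 / (m.R1 * m.C1)) * (z t).x1 - 1 / m.C1 * (z t).x3 + 1 / (m.R1 * m.C1) * m.VPV = _
    field_simp
    ring
  · refine ((hz.hasDerivWithinAt_fst 2 ht).sub_const _).congr_deriv ?_
    rw [closedLoop_x3 hm (hz t ht).1, v1, z3]
    field_simp
    ring
  · refine (hz.hasDerivWithinAt_snd 1 ht).congr_deriv ?_
    change g.pv.kiInt * ((z t).x3 - z3 m g r (z t)) = _
    rw [z3]
    field_simp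
    ring

theorem IsTrajectory.expDecay_bat (hm : m.Positive) (hg : g.Proper m)
    (hz : IsTrajectory m RL g r z) :
    ExpDecay (fun t => (z t).x4 - r.x4) ∧
      ExpDecay (fun t => (z t).x6 - 1 / m.R4 * (m.VB - r.x4)) := by
  have hR := hm.R4.ne'
  have hC := hm.C4.ne'
  refine hg.2.1.expDecay (a := fun t => (z t).al4) (b := fun t => (z t).al6) (fun t ht => ?_)
    (fun t ht => hz.hasDerivWithinAt_snd 2 ht) (fun t ht => ?_) (fun t ht => ?_)
  · refine ((hz.hasDerivWithinAt_fst 3 ht).sub_const r.x4).congr_deriv ?_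
    change -(1 / (m.R4 * m.C4)) * (z t).x4 - 1 / m.C4 * (z t).x6 + 1 / (m.R4 * m.C4) * m.VB = _
    field_simp
    ring
  · refine ((hz.hasDerivWithinAt_fst 5 ht).sub_const _).congr_deriv ?_
    rw [closedLoop_x6 hm (hz t ht).1, v2, z6]
    field_simp
    ring
  · refine (hz.hasDerivWithinAt_snd 3 ht).congr_deriv ?_
    change g.bat.kiInt * ((z t).x6 - z6 m g r (z t)) = _
    rw [z6]
    field_simp
    ring

theorem partialField_x8 (s : State) (w : ℝ) : (partialField m RL g r s w).1 7
    = 1 / m.L8 * m.VS * w - m.R08 / m.L8 * s.x8 - 1 / m.L8 * s.x7 := rfl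

/-- Only the equation of `x₈` involves `u₃`. -/
theorem closedLoop_eq_partialField (s : State) {i : Fin 9} (hi : i ≠ 7) :
    (closedLoop m RL g r s).1 i = (partialField m RL g r s 0).1 i := by
  rw [closedLoop, partialField_eq_add]
  simp [unitVec, hi]

theorem IsTrajectory.hasDerivWithinAt_z7 (hz : IsTrajectory m RL g r z) {t : ℝ} (ht : 0 ≤ t) :
    HasDerivWithinAt (fun t => z7 m RL g r (z t)) (z7Dot m RL g r (z t)) (Ici 0) t :=
  hz.hasDerivWithinAt_comp ht (differentiableAt_z7 (hz t ht).1) (z7_add_unitVec (.inr rfl) (z t))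

theorem IsTrajectory.hasDerivWithinAt_z7Dot (hz : IsTrajectory m RL g r z) {t : ℝ} (ht : 0 ≤ t) :
    HasDerivWithinAt (fun t => z7Dot m RL g r (z t)) (z7DDot m RL g r (z t)) (Ici 0) t :=
  hz.hasDerivWithinAt_comp ht (differentiableAt_z7Dot (hz t ht).1) (z7Dot_add_unitVec (hz t ht).1)

theorem IsTrajectory.hasDerivWithinAt_z8 (hz : IsTrajectory m RL g r z) {t : ℝ} (ht : 0 ≤ t) :
    HasDerivWithinAt (fun t => z8 m RL g r (z t)) (z8Dot m RL g r (z t)) (Ici 0) t := by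
  have hx7 := hz.hasDerivWithinAt_fst 6 ht
  have hx9 := hz.hasDerivWithinAt_fst 8 ht
  rw [closedLoop_eq_partialField _ (by decide)] at hx7 hx9
  exact (((hx7.sub (hz.hasDerivWithinAt_z7 ht)).const_mul (m.C7 * g.K7)).sub
    ((hx7.sub hx9).const_mul (1 / m.R7))).sub ((hz.hasDerivWithinAt_z7Dot ht).const_mul m.C7)

/-- Substituting `u3` leaves the error equation `ė = -K8 e`. -/
theorem IsTrajectory.expDecay_x8_sub_z8 (hm : m.Positive) (hg : g.Proper m)
    (hz : IsTrajectory m RL g r z) :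
    ExpDecay (fun t => (z t).x8 - z8 m RL g r (z t)) := by
  refine ExpDecay.of_hasDerivWithinAt_real (f := fun _ => 0) hg.2.2.2
    ⟨0, 1, le_rfl, one_pos, by simp⟩ fun t ht => ?_
  refine ((hz.hasDerivWithinAt_fst 7 ht).sub (hz.hasDerivWithinAt_z8 ht)).congr_deriv ?_
  have := hm.L8.ne'
  have := hm.VS.ne'
  rw [closedLoop, partialField_x8, u3]
  generalize z8Dot m RL g r (z t) = a
  generalize z8 m RL g r (z t) = b
  field_simp
  ring

/-- The choice of `z8` turns the error equation into `ė = -K7 e - (x₈ - z8) / C₇`, with an input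
already known to decay. -/
theorem IsTrajectory.expDecay_x7_sub_z7 (hm : m.Positive) (hg : g.Proper m)
    (hz : IsTrajectory m RL g r z) :
    ExpDecay (fun t => (z t).x7 - z7 m RL g r (z t)) := by
  have h8 : ExpDecay fun t => -(1 / m.C7) * ((z t).x8 - z8 m RL g r (z t)) :=
    (hz.expDecay_x8_sub_z8 hm hg).of_norm_le |(-(1 / m.C7))| (abs_nonneg _)
      fun t _ => (norm_mul _ _).le
  refine ExpDecay.of_hasDerivWithinAt_real hg.2.2.1 h8 fun t ht => ?_
  refine ((hz.hasDerivWithinAt_fst 6 ht).sub (hz.hasDerivWithinAt_z7 ht)).congr_deriv ?_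
  change -(1 / (m.R7 * m.C7)) * (z t).x7 - 1 / m.C7 * (z t).x8 + 1 / (m.R7 * m.C7) * (z t).x9
    - z7Dot m RL g r (z t) = _
  have := hm.C7.ne'
  have := hm.R7.ne'
  rw [z8]
  field_simp
  ring

/-- The energy balance of the grid voltages. -/
theorem energy_balance (hm : m.Positive) (hRL : RL ≠ 0) {s : State} (hs : s ∈ domain m) :
    m.C9 * (s.x9 * (closedLoop m RL g r s).1 8)
      + m.C2 * ((s.x2 - x2Star m r) * (closedLoop m RL g r s).1 1)
      + m.C5 * ((s.x5 - x5Star m r) * (closedLoop m RL g r s).1 4)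
    = -(1 / m.R2 * (s.x2 - x2Star m r) ^ 2 + 1 / m.R5 * (s.x5 - x5Star m r) ^ 2
        + 1 / m.R7 * (s.x9 - r.x9) ^ 2)
      + 1 / m.R7 * s.x9 * (s.x7 - z7 m RL g r s) := by
  have h9 : s.x9 ≠ 0 := hs.2.2
  have := hm.R2.ne'
  have := hm.R5.ne'
  have := hm.R7.ne'
  have := hm.C2.ne'
  have := hm.C5.ne'
  have := hm.C9.ne'
  change m.C9 * (s.x9 * (1 / m.C9 * ((s.x2 - s.x9) / m.R2 + (s.x5 - s.x9) / m.R5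
        + (s.x7 - s.x9) / m.R7 - s.x9 * (1 / RL))))
      + m.C2 * ((s.x2 - x2Star m r) * (-(1 / (m.R2 * m.C2)) * s.x2 + 1 / m.C2 * s.x3
        - 1 / m.C2 * u1 m g r s * s.x3 + 1 / (m.R2 * m.C2) * s.x9))
      + m.C5 * ((s.x5 - x5Star m r) * (-(1 / (m.R5 * m.C5)) * s.x5 + 1 / m.C5 * s.x6
        - 1 / m.C5 * u2 m g r s * s.x6 + 1 / (m.R5 * m.C5) * s.x9)) = _
  -- The terms of `z7` cancel the cross terms and the load current; its last term completes `-x₉² /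
  -- R₇` to `-(x₉ - x₉*)² / R₇`.
  rw [z7]
  field_simp
  ring

/-! ### Convergence to the equilibrium. -/

theorem IsTrajectory.tendsto_xEq (hm : m.Positive) (hg : g.Proper m) (hRL : 0 < RL)
    (hr9 : 0 < r.x9) (hbal : CurrentBalance m RL r) (hz : IsTrajectory m RL g r z)
    (hu : ∀ t, 0 ≤ t → DutyBounded m RL g r (z t)) :
    Tendsto (fun t => (z t).1) atTop (𝓝 (xEq m r)) := by
  obtain ⟨hpv1, hpv3⟩ := hz.expDecay_pv hm hg
  obtain ⟨hb4, hb6⟩ := hz.expDecay_bat hm hg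
  have hp := hz.expDecay_x7_sub_z7 hm hg
  have hadd : ∀ {f : ℝ → ℝ} {c : ℝ}, Tendsto (fun t => f t - c) atTop (𝓝 0) →
      Tendsto f atTop (𝓝 c) := fun {f c} h => by simpa using h.add_const c
  have t1 : Tendsto (fun t => (z t).x1) atTop (𝓝 r.x1) := hadd hpv1.tendsto
  have t3 : Tendsto (fun t => (z t).x3) atTop (𝓝 (1 / m.R1 * (m.VPV - r.x1))) :=
    hadd hpv3.tendsto
  have t4 : Tendsto (fun t => (z t).x4) atTop (𝓝 r.x4) := hadd hb4.tendsto
  have t6 : Tendsto (fun t => (z t).x6) atTop (𝓝 (1 / m.R4 * (m.VB - r.x4))) := hadd hb6.tendsto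
  have hcont : ∀ i, ContinuousOn (fun t => (z t).1 i) (Ici 0) := fun i t ht =>
    (hz.hasDerivWithinAt_fst i ht).continuousWithinAt
  obtain ⟨B3, hB3⟩ := bounded_of_tendsto (hcont 2) t3
  obtain ⟨B6, hB6⟩ := bounded_of_tendsto (hcont 5) t6
  have hB30 : 0 ≤ B3 := (abs_nonneg _).trans (hB3 0 le_rfl)
  have hB60 : 0 ≤ B6 := (abs_nonneg _).trans (hB6 0 le_rfl)
  have hR2 := hm.R2
  have hR5 := hm.R5
  have hR7 := hm.R7
  have hC2 := hm.C2
  have hC5 := hm.C5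
  have hC7 := hm.C7
  obtain ⟨y2, y5, t9⟩ := tendsto_of_energy hm.C2 hm.C5 hm.C9 (one_div_pos.2 hR2)
    (one_div_pos.2 hR5) (one_div_pos.2 hR7)
    (M2 := 1 / (m.R2 * m.C2) * (1 + |x2Star m r|) + 1 / m.C2 * B3)
    (M5 := 1 / (m.R5 * m.C5) * (1 + |x5Star m r|) + 1 / m.C5 * B6)
    (by positivity) (by positivity)
    (fun t ht => (hz.hasDerivWithinAt_fst 1 ht).sub_const (x2Star m r))
    (fun t ht => (hz.hasDerivWithinAt_fst 4 ht).sub_const (x5Star m r))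
    (fun t ht => hz.hasDerivWithinAt_fst 8 ht)
    (fun t ht => energy_balance hm hRL.ne' (hz t ht).1) hp (fun t ht => (hz t ht).1.2.2)
    (fun t ht => abs_capacitor_le hR2 hC2 (hB3 t ht) (hu t ht).1)
    (fun t ht => abs_capacitor_le hR5 hC5 (hB6 t ht) (hu t ht).2.1)
  have t2 : Tendsto (fun t => (z t).x2) atTop (𝓝 (x2Star m r)) := hadd y2
  have t5 : Tendsto (fun t => (z t).x5) atTop (𝓝 (x5Star m r)) := hadd y5
  have t9' : Tendsto (fun t => (z t).x9) atTop (𝓝 r.x9) := t9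
  -- No limit of `u1` is needed: it is bounded and multiplied by a vanishing error.
  have w2 : Tendsto (fun t => ((z t).x2 - x2Star m r) * (1 / m.R2 * ((z t).x9 - x2Star m r)
      + (z t).x3 * (1 - u1 m g r (z t)))) atTop (𝓝 0) := by
    have a1 := y2.mul ((t9'.sub_const (x2Star m r)).const_mul (1 / m.R2))
    have a2 := tendsto_mul_zero_of_mem_Icc (by simpa using y2.mul t3) fun t ht => (hu t ht).1
    rw [zero_mul] at a1
    have a3 := a1.add a2
    rw [add_zero] at a3
    exact a3.congr fun t => by ring
  have w5 : Tendsto (fun t => ((z t).x5 - x5Star m r) * (1 / m.R5 * ((z t).x9 - x5Star m r)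
      + (z t).x6 * (1 - u2 m g r (z t)))) atTop (𝓝 0) := by
    have a1 := y5.mul ((t9'.sub_const (x5Star m r)).const_mul (1 / m.R5))
    have a2 := tendsto_mul_zero_of_mem_Icc (by simpa using y5.mul t6) fun t ht => (hu t ht).2.1
    rw [zero_mul] at a1
    have a3 := a1.add a2
    rw [add_zero] at a3
    exact a3.congr fun t => by ring
  have tz7 : Tendsto (fun t => z7 m RL g r (z t)) atTop (𝓝 r.x9) := by
    have hinv : Tendsto (fun t => 1 / (z t).x9) atTop (𝓝 (1 / r.x9)) :=
      tendsto_const_nhds.div t9' hr9.ne'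
    have key := ((((hinv.const_mul (-m.R7)).mul w2).sub ((hinv.const_mul m.R7).mul w5)).add
      ((((t9'.div_const RL).sub ((t2.sub t9').const_mul (1 / m.R2))).sub
        ((t5.sub t9').const_mul (1 / m.R5))).const_mul m.R7)).add
      (hinv.mul ((t9'.mul_const r.x9).const_mul 2 |>.const_add (-r.x9 ^ 2)))
    have hb := hbal.2.2
    -- The current balance makes the bracket in `z7` vanish at the limit.
    have e : r.x9 / RL - 1 / m.R2 * (x2Star m r - r.x9) - 1 / m.R5 * (x5Star m r - r.x9) = 0 := by
      rw [← one_div_mul_eq_div, hb]; ring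
    rw [e] at key
    have e2 : -m.R7 * (1 / r.x9) * 0 - m.R7 * (1 / r.x9) * 0 + m.R7 * 0
        + 1 / r.x9 * (-r.x9 ^ 2 + 2 * (r.x9 * r.x9)) = r.x9 := by
      have := hr9.ne'
      field_simp
      ring
    rw [e2] at key
    refine key.congr fun t => ?_
    rw [z7]
    ring
  have t7 : Tendsto (fun t => (z t).x7) atTop (𝓝 r.x9) := by
    simpa using hp.tendsto.add tz7
  have b2 : BddOnHalfLine fun t => (z t).x2 := bounded_of_tendsto (hcont 1) t2
  have b5 : BddOnHalfLine fun t => (z t).x5 := bounded_of_tendsto (hcont 4) t5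
  have b7 : BddOnHalfLine fun t => (z t).x7 := bounded_of_tendsto (hcont 6) t7
  have b9 : BddOnHalfLine fun t => (z t).x9 := bounded_of_tendsto (hcont 8) t9'
  have bu : BddOnHalfLine fun t => u3 m RL g r (z t) :=
    ⟨1, fun t ht => abs_le.2 ⟨by linarith [(hu t ht).2.2.1], (hu t ht).2.2.2⟩⟩
  -- The bound comes from the stable equation of `x₈` with `u3` as a bounded input, so the
  -- derivatives inside `z8` need not be estimated.
  have b8 : BddOnHalfLine fun t => (z t).x8 := by
    obtain ⟨K, hK⟩ := (bu.const_mul (1 / m.L8 * m.VS)).sub (b7.const_mul (1 / m.L8))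
    refine bounded_of_hasDerivWithinAt (div_pos hm.R08 hm.L8) hK fun t ht => ?_
    refine (hz.hasDerivWithinAt_fst 7 ht).congr_deriv ?_
    change 1 / m.L8 * m.VS * u3 m RL g r (z t) - m.R08 / m.L8 * (z t).x8
      - 1 / m.L8 * (z t).x7 = _
    ring
  set d : Fin 9 → ℝ → ℝ := fun i t => (closedLoop m RL g r (z t)).1 i with hd
  have d7 : ∀ t, d 6 t = -(1 / (m.R7 * m.C7)) * (z t).x7 - 1 / m.C7 * (z t).x8
      + 1 / (m.R7 * m.C7) * (z t).x9 := fun t => rfl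
  have bd7 : BddOnHalfLine (d 6) :=
    ((b7.const_mul (-(1 / (m.R7 * m.C7)))).sub (b8.const_mul (1 / m.C7))).add
      (b9.const_mul (1 / (m.R7 * m.C7)))
  have bd8 : BddOnHalfLine (d 7) :=
    ((bu.const_mul (1 / m.L8 * m.VS)).sub (b8.const_mul (m.R08 / m.L8))).sub
      (b7.const_mul (1 / m.L8))
  have bd9 : BddOnHalfLine (d 8) := by
    obtain ⟨K, hK⟩ := (((((b2.sub b9).const_mul (1 / m.R2)).add
      ((b5.sub b9).const_mul (1 / m.R5))).add ((b7.sub b9).const_mul (1 / m.R7))).sub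
      (b9.const_mul (1 / RL))).const_mul (1 / m.C9)
    refine ⟨K, fun t ht => le_trans (le_of_eq ?_) (hK t ht)⟩
    change |1 / m.C9 * (((z t).x2 - (z t).x9) / m.R2 + ((z t).x5 - (z t).x9) / m.R5
      + ((z t).x7 - (z t).x9) / m.R7 - (z t).x9 * (1 / RL))| = _
    congr 1
    ring
  have hdd : ∀ t, 0 ≤ t → HasDerivWithinAt (d 6) (-(1 / (m.R7 * m.C7)) * d 6 t
      - 1 / m.C7 * d 7 t + 1 / (m.R7 * m.C7) * d 8 t) (Ici 0) t := fun t ht =>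
    (((hz.hasDerivWithinAt_fst 6 ht).const_mul _).sub
      ((hz.hasDerivWithinAt_fst 7 ht).const_mul _)).add
      ((hz.hasDerivWithinAt_fst 8 ht).const_mul _)
  obtain ⟨K, hK⟩ := ((bd7.const_mul (-(1 / (m.R7 * m.C7)))).sub (bd8.const_mul (1 / m.C7))).add
    (bd9.const_mul (1 / (m.R7 * m.C7)))
  have td7 : Tendsto (d 6) atTop (𝓝 0) :=
    tendsto_deriv_zero_of_bounded t7 (fun t ht => hz.hasDerivWithinAt_fst 6 ht) hdd hK
  -- Solve the equation of `x₇` for `x₈`: both `x₉ - x₇` and `ẋ₇` vanish in the limit.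
  have t8 : Tendsto (fun t => (z t).x8) atTop (𝓝 0) := by
    have key := ((t9'.sub t7).const_mul (1 / m.R7)).sub (td7.const_mul m.C7)
    rw [sub_self, mul_zero, mul_zero, sub_zero] at key
    refine key.congr fun t => ?_
    rw [d7]
    field_simp
    ring
  rw [tendsto_pi_nhds]
  intro i
  fin_cases i
  exacts [t1, t2, t3, t4, t5, t6, t7, t8, t9']

end DCGrid

theorem mainTheorem2 (m : DCGrid.Params) (hm : m.Positive) (g : DCGrid.Gains) (hg : g.Proper m)
    (r : DCGrid.Refs) (hx9 : r.x9 ∈ Set.Ioo (max m.VPV m.VB) m.VS)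
    (RL : ℝ) (hRL : RL ∈ DCGrid.OmegaRL m r.x9)
    (hx1 : r.x1 ∈ Set.Icc (DCGrid.gamma1 m * m.VPV) m.VPV)
    (hx4 : r.x4 ∈ Set.Icc (DCGrid.gamma2 m * m.VB) (DCGrid.beta m r.x9))
    (hbal : DCGrid.CurrentBalance m RL r) :
    ∀ z₀ ∈ DCGrid.OmegaK m RL g r,
      (∃ z, DCGrid.IsTrajectory m RL g r z ∧ z 0 = z₀) ∧
      ∀ z, DCGrid.IsTrajectory m RL g r z → z 0 = z₀ →
        Filter.Tendsto (fun t => (z t).1) Filter.atTop (nhds (DCGrid.xEq m r)) ∧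
        ∀ t : ℝ, 0 ≤ t →
          DCGrid.u1 m g r (z t) ∈ Set.Icc (0 : ℝ) 1 ∧
          DCGrid.u2 m g r (z t) ∈ Set.Icc (0 : ℝ) 1 ∧
          DCGrid.u3 m RL g r (z t) ∈ Set.Icc (0 : ℝ) 1 := by
  intro z₀ hz₀
  -- The union `OmegaK` is itself invariant and duty-bounded, which settles everything except
  -- convergence.
  obtain ⟨⟨hinv, hduty⟩, -⟩ := DCGrid.isGreatest_omegaK m RL g r
  refine ⟨(hinv z₀ hz₀).1, fun z hz h0 => ?_⟩
  have hu : ∀ t, 0 ≤ t → DCGrid.DutyBounded m RL g r (z t) := fun t ht =>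
    hduty _ ((hinv z₀ hz₀).2 z hz h0 t ht)
  have hr9 : 0 < r.x9 := (hm.VPV.trans_le (le_max_left _ _)).trans hx9.1
  exact ⟨hz.tendsto_xEq hm hg hRL.1 hr9 hbal hu, hu⟩
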